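/- Let $n\ge 4$. Write $n\times n$ matrices in blocks of sizes $1,2,n-3$, and let $H=SO(2)\times SO(n-3)\subset SO(n)$ be the subgroup of matrices $\mathrm{diag}(1,P,Q)$ with $P\in SO(2)$, $Q\in SO(n-3)$. Consider $SO(n)/H$ as the homogeneous $6$-symmetric space generated by the automorphism $\Phi(A)=BAB^{-1}$ of $SO(n)$, where $$B=\mathrm{diag}\Big(1,\begin{pmatrix}\tfrac12&\tfrac{\sqrt3}{2}\\-\tfrac{\sqrt3}{2}&\tfrac12\end{pmatrix},-1,\dots,-1\Big).$$ Let $\varphi=d\Phi_e$, let $\mathfrak m=(\varphi-\mathrm{id})\,\mathfrak{so}(n)$ be the canonical reductive complement, identified with the tangent space of $SO(n)/H$ at the base point, and let $\theta=\varphi|_{\mathfrak m}$. Denote by $$f_1=\tfrac1{\sqrt3}(\theta-\theta^5),\quad f_2=\tfrac1{2\sqrt3}(\theta-\theta^2+\theta^4-\theta^5),\quad f_3=\tfrac1{2\sqrt3}(\theta+\theta^2-\theta^4-\theta^5),\quad f_4=\tfrac1{\sqrt3}(\theta^2-\theta^4)$$ the canonical $f$-structures, regarded as $SO(n)$-invariant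 tensor fields of type $(1,1)$ on $SO(n)/H$. Let $\mathfrak m=\mathfrak m_1\oplus\mathfrak m_2\oplus\mathfrak m_3$, where $\mathfrak m_1,\mathfrak m_2,\mathfrak m_3$ consist of the skew-symmetric matrices supported in the off-diagonal blocks of sizes $1\times2$, $2\times(n-3)$, $1\times(n-3)$ and their transposes, respectively. Let $g_0$ be minus the Killing form of $\mathfrak{so}(n)$. Let $s,t>0$ and let $g$ be the invariant Riemannian metric on $SO(n)/H$ with characteristic numbers $(s,t)$, i.e. $g=c\,(g_0|_{\mathfrak m_1}+s\,g_0|_{\mathfrak m_2}+t\,g_0|_{\mathfrak m_3})$ at the base point, for some $c>0$. Let $\nabla$ be its Levi-Civita connection. A metric $f$-structure is a field $f$ of endomorphisms of the tangent bundle with $f^3+f=0$ and $g(fX,Y)+g(X,fY)=0$ for all vector fields $X,Y$. It is called a Killing $f$-structure if $(\nabla_Xf)X=0$ for all vector fields $X$; an $NKf$-structure (nearly Kähler) if $(\nabla_{fX}f)fX=0$ for all $X$; and a $G_1f$-structure if $T(X,X)=0$ for all $X$, where $T(X,Y)=\tfrac14 f\big((\nabla_{fX}f)fY-(\nabla_{f^2X}f)f^2Y\big)$.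 Then: 1. $f_1$ is a Killing $f$-structure if and only if $s=1$ and $t=\tfrac43$; $f_2,f_3,f_4$ are not Killing $f$-structures for any $s$ and $t$. 2. $f_1$ is an $NKf$-structure if and only if $s=1$; $f_2$ and $f_3$ are $NKf$-structures for all $s$ and $t$; $f_4$ is not an $NKf$-structure for any $s$ and $t$. 3. $f_1,f_2,f_3,f_4$ are $G_1f$-structures for all $s$ and $t$. -/

import Mathlib

open scoped Matrix ContDiff

-- The norm only serves to speak of smooth maps on the finite-dimensional space of matrices.
attribute [local instance] Matrix.linftyOpNormedAddCommGroup Matrix.linftyOpNormedSpace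

-- The commutator bracket on matrices.
attribute [local instance] LieRing.ofAssociativeRing

namespace FlagSO

noncomputable section

/-! ### The groups `SO(n)` and `H = SO(2) × SO(n-3)` -/

/-- The index set `{1, …, n}` (for `n ≥ 3`), split into blocks of sizes `1`, `2` and `n - 3`. -/
abbrev Idx (n : ℕ) : Type := Fin 1 ⊕ Fin 2 ⊕ Fin (n - 3)

/-- Real `n × n` matrices. -/
abbrev Mat (n : ℕ) : Type := Matrix (Idx n) (Idx n) ℝ

/-- The group `SO(n)`. -/
abbrev SO (n : ℕ) : Type := Matrix.specialOrthogonalGroup (Idx n) ℝ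

/-- The Lie algebra `so(n)` of skew-symmetric matrices. -/
abbrev so (n : ℕ) : LieSubalgebra ℝ (Mat n) := LieAlgebra.Orthogonal.so (Idx n) ℝ

/-- The block-diagonal matrix `diag(1, P, Q)`. -/
def blockDiag {n : ℕ} (P : Matrix (Fin 2) (Fin 2) ℝ) (Q : Matrix (Fin (n - 3)) (Fin (n - 3)) ℝ) :
    Mat n :=
  Matrix.fromBlocks 1 0 0 (Matrix.fromBlocks P 0 0 Q)

theorem blockDiag_mul {n : ℕ} (P P' : Matrix (Fin 2) (Fin 2) ℝ)
    (Q Q' : Matrix (Fin (n - 3)) (Fin (n - 3)) ℝ) :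
    blockDiag P Q * blockDiag P' Q' = blockDiag (P * P') (Q * Q') := by
  simp [blockDiag, Matrix.fromBlocks_multiply]

theorem blockDiag_transpose {n : ℕ} (P : Matrix (Fin 2) (Fin 2) ℝ)
    (Q : Matrix (Fin (n - 3)) (Fin (n - 3)) ℝ) :
    (blockDiag P Q)ᵀ = blockDiag Pᵀ Qᵀ := by
  simp [blockDiag, Matrix.fromBlocks_transpose]

theorem coe_inv {n : ℕ} (g : SO n) : ((g⁻¹ : SO n) : Mat n) = (g : Mat n)ᵀ := rfl

/-- The subgroup `SO(2) × SO(n-3)` of `SO(n)`, consisting of the matrices `diag(1, P, Q)` with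
`P ∈ SO(2)` and `Q ∈ SO(n-3)`. -/
def H (n : ℕ) : Subgroup (SO n) where
  carrier := {A | ∃ P ∈ Matrix.specialOrthogonalGroup (Fin 2) ℝ,
    ∃ Q ∈ Matrix.specialOrthogonalGroup (Fin (n - 3)) ℝ, (A : Mat n) = blockDiag P Q}
  mul_mem' := by
    rintro a b ⟨P, hP, Q, hQ, ha⟩ ⟨P', hP', Q', hQ', hb⟩
    exact ⟨P * P', mul_mem hP hP', Q * Q', mul_mem hQ hQ', by
      rw [Submonoid.coe_mul, ha, hb, blockDiag_mul]⟩
  one_mem' := ⟨1, one_mem _, 1, one_mem _, by simp [blockDiag]⟩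
  inv_mem' := by
    rintro a ⟨P, hP, Q, hQ, ha⟩
    refine ⟨Pᵀ, ?_, Qᵀ, ?_, by rw [coe_inv, ha, blockDiag_transpose]⟩
    · exact (⟨P, hP⟩ : Matrix.specialOrthogonalGroup (Fin 2) ℝ)⁻¹.2
    · exact (⟨Q, hQ⟩ : Matrix.specialOrthogonalGroup (Fin (n - 3)) ℝ)⁻¹.2

/-- The adjoint action of `SO(n)` on `so(n)`, `Ad(g) X = g X g⁻¹`. -/
def Ad {n : ℕ} (g : SO n) : so n →ₗ[ℝ] so n where
  toFun X := ⟨(g : Mat n) * (X : Mat n) * ((g⁻¹ : SO n) : Mat n), by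
    have hX := (LieAlgebra.Orthogonal.mem_so (Idx n) ℝ _).1 X.2
    rw [LieAlgebra.Orthogonal.mem_so, coe_inv]
    simp [Matrix.transpose_mul, hX, Matrix.mul_assoc]⟩
  map_add' X Y := by ext1; simp [mul_add, add_mul]
  map_smul' a X := by ext1; simp

/-! ### The automorphism of order `6` and the canonical reductive complement -/

/-- The orthogonal matrix `B = diag(1, R, -1, …, -1)`, where `R` is the rotation matrix
with rows `(cos (π/3), sin (π/3))` and `(-sin (π/3), cos (π/3))`. -/
def B (n : ℕ) : Mat n :=
  blockDiag !![1 / 2, √3 / 2; -(√3 / 2), 1 / 2] (-1)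

/-- The differential at the identity, `X ↦ B X B⁻¹`, of the automorphism `Φ(A) = B A B⁻¹` of
`SO(n)` (note that `B⁻¹ = Bᵀ`). -/
def phi (n : ℕ) : so n →ₗ[ℝ] so n where
  toFun X := ⟨B n * (X : Mat n) * (B n)ᵀ, by
    have hX := (LieAlgebra.Orthogonal.mem_so (Idx n) ℝ _).1 X.2
    rw [LieAlgebra.Orthogonal.mem_so]
    simp [Matrix.transpose_mul, hX, Matrix.mul_assoc]⟩
  map_add' X Y := by ext1; simp [mul_add, add_mul]
  map_smul' a X := by ext1; simp

/-- The canonical reductive complement `𝔪 = (φ - id) so(n)`. -/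
def m (n : ℕ) : Submodule ℝ (so n) := LinearMap.range (phi n - LinearMap.id)

/-- The restriction `θ` of `φ` to `𝔪`. -/
def theta (n : ℕ) : Module.End ℝ (m n) :=
  (phi n).restrict (by
    rintro _ ⟨X, rfl⟩
    exact ⟨phi n X, by simp⟩)

theorem B_comm_H {n : ℕ} (h : H n) : B n * ((h : SO n) : Mat n) = ((h : SO n) : Mat n) * B n := by
  obtain ⟨h, P, hP, Q, hQ, hh⟩ := h
  obtain ⟨hP1, hP2⟩ := Matrix.mem_specialOrthogonalGroup_fin_two_iff.1 hP
  simp only [hh, B, blockDiag_mul]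
  congr 1
  · ext i j
    fin_cases i <;> fin_cases j <;> simp [Matrix.mul_apply, Fin.sum_univ_two, hP1, hP2] <;> ring
  · simp

theorem phi_Ad {n : ℕ} (h : H n) (X : so n) : phi n (Ad (h : SO n) X) = Ad (h : SO n) (phi n X) := by
  ext1
  have h1 := B_comm_H h
  have h3 : ((h : SO n) : Mat n)ᵀ * (B n)ᵀ = (B n)ᵀ * ((h : SO n) : Mat n)ᵀ := by
    rw [← Matrix.transpose_mul, ← Matrix.transpose_mul, h1]
  simp only [phi, Ad, LinearMap.coe_mk, AddHom.coe_mk, coe_inv]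
  calc B n * (((h : SO n) : Mat n) * (X : Mat n) * ((h : SO n) : Mat n)ᵀ) * (B n)ᵀ
      = (B n * ((h : SO n) : Mat n)) * (X : Mat n) * (((h : SO n) : Mat n)ᵀ * (B n)ᵀ) := by
        simp only [Matrix.mul_assoc]
    _ = _ := by rw [h1, h3]; simp only [Matrix.mul_assoc]

/-- The isotropy representation of `H` on `𝔪`. -/
def AdM {n : ℕ} (h : H n) : Module.End ℝ (m n) :=
  (Ad (h : SO n)).restrict (by
    rintro _ ⟨X, rfl⟩
    exact ⟨Ad (h : SO n) X, by simp [phi_Ad]⟩)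

/-! ### Invariant affinor structures -/

/-- The algebra of invariant affinor structures on `SO(n)/H`, identified with their values at the
base point: the endomorphisms of `𝔪` that commute with `Ad(H)`. -/
def Affinor (n : ℕ) : Subalgebra ℝ (Module.End ℝ (m n)) :=
  Subalgebra.centralizer ℝ (Set.range (AdM : H n → Module.End ℝ (m n)))

/-- `θ` as an invariant affinor structure. -/
def thetaA (n : ℕ) : Affinor n :=
  ⟨theta n, by
    rw [Affinor, Subalgebra.mem_centralizer_iff]
    rintro _ ⟨h, rfl⟩
    ext1 X
    exact Subtype.ext (phi_Ad h X).symm⟩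

/-- `f₁ = (θ - θ⁵) / √3`. -/
def f₁ (n : ℕ) : Affinor n := (1 / √3) • (thetaA n - thetaA n ^ 5)

/-- `f₂ = (θ - θ² + θ⁴ - θ⁵) / (2√3)`. -/
def f₂ (n : ℕ) : Affinor n :=
  (1 / (2 * √3)) • (thetaA n - thetaA n ^ 2 + thetaA n ^ 4 - thetaA n ^ 5)

/-- `f₃ = (θ + θ² - θ⁴ - θ⁵) / (2√3)`. -/
def f₃ (n : ℕ) : Affinor n :=
  (1 / (2 * √3)) • (thetaA n + thetaA n ^ 2 - thetaA n ^ 4 - thetaA n ^ 5)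

/-- `f₄ = (θ² - θ⁴) / √3`. -/
def f₄ (n : ℕ) : Affinor n := (1 / √3) • (thetaA n ^ 2 - thetaA n ^ 4)

/-! ### Invariant metrics -/

/-- The number (`0`, `1` or `2`) of the block to which an index belongs. -/
def blk {n : ℕ} : Idx n → Fin 3
  | Sum.inl _ => 0
  | Sum.inr (Sum.inl _) => 1
  | Sum.inr (Sum.inr _) => 2

/-- The part of a skew-symmetric matrix that lies in the blocks `(a, b)` and `(b, a)`; all other
entries are replaced by `0`. -/
def part {n : ℕ} (a b : Fin 3) (X : so n) : so n :=
  ⟨Matrix.of fun i j => if (blk i = a ∧ blk j = b) ∨ (blk i = b ∧ blk j = a)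
      then (X : Mat n) i j else 0, by
    have hX := (LieAlgebra.Orthogonal.mem_so (Idx n) ℝ _).1 X.2
    rw [LieAlgebra.Orthogonal.mem_so]
    ext i j
    have hij : (X : Mat n) j i = -(X : Mat n) i j := congrFun (congrFun hX i) j
    by_cases hc : (blk i = a ∧ blk j = b) ∨ (blk i = b ∧ blk j = a)
    · have hc' : (blk j = a ∧ blk i = b) ∨ (blk j = b ∧ blk i = a) := by tauto
      simp [hc, hc', hij]
    · have hc' : ¬((blk j = a ∧ blk i = b) ∨ (blk j = b ∧ blk i = a)) := by tauto
      simp [hc, hc']⟩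

/-- The form `g₀ = -(Killing form of so(n))`. -/
def g₀ {n : ℕ} (X Y : so n) : ℝ := -killingForm ℝ (so n) X Y

/-- The invariant metric `c · (g₀|𝔪₁ + s g₀|𝔪₂ + t g₀|𝔪₃)`, as an inner product on `𝔪`; here
`𝔪 = 𝔪₁ ⊕ 𝔪₂ ⊕ 𝔪₃`, where `𝔪₁`, `𝔪₂`, `𝔪₃` correspond to the blocks of sizes `1 × 2`,
`2 × (n-3)` and `1 × (n-3)`. -/
def metric {n : ℕ} (c s t : ℝ) (X Y : m n) : ℝ :=
  c * (g₀ (part 0 1 (X : so n)) (part 0 1 (Y : so n))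
    + s * g₀ (part 1 2 (X : so n)) (part 1 2 (Y : so n))
    + t * g₀ (part 0 2 (X : so n)) (part 0 2 (Y : so n)))

/-! ### Functions and vector fields on `SO(n)/H` -/

/-- The algebra `C^∞(SO(n)/H)`: the functions whose pull-back to `SO(n)` is smooth, i.e. extends
to a smooth function of matrices (`SO(n)` is a closed submanifold of the space of matrices). -/
def Smooth (n : ℕ) : Subalgebra ℝ (SO n ⧸ H n → ℝ) where
  carrier := {u | ∃ F : Mat n → ℝ, ContDiff ℝ ∞ F ∧ ∀ g : SO n, u (g : SO n ⧸ H n) = F g}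
  mul_mem' := by
    rintro u v ⟨F, hF, hu⟩ ⟨G, hG, hv⟩
    exact ⟨fun x => F x * G x, hF.mul hG, fun g => by simp [hu, hv]⟩
  add_mem' := by
    rintro u v ⟨F, hF, hu⟩ ⟨G, hG, hv⟩
    exact ⟨fun x => F x + G x, hF.add hG, fun g => by simp [hu, hv]⟩
  algebraMap_mem' r := ⟨fun _ => r, contDiff_const, fun _ => rfl⟩

/-- The space of smooth vector fields on `SO(n)/H`, as sections of `T(SO(n)/H) = SO(n) ×_H 𝔪`:
smooth maps `X : SO(n) → 𝔪` with `X(gh) = Ad(h⁻¹) X(g)` for `h ∈ H`. The tangent vector at the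
point `gH` is the velocity at time `0` of the curve `τ ↦ g exp(τ X(g)) H`. -/
def VectorField (n : ℕ) : Submodule ℝ (SO n → m n) where
  carrier := {X | (∃ F : Mat n → Mat n, ContDiff ℝ ∞ F ∧ ∀ g : SO n, ((X g : so n) : Mat n) = F g) ∧
    ∀ (g : SO n) (h : H n), X (g * (h : SO n)) = AdM h⁻¹ (X g)}
  add_mem' := by
    rintro X Y ⟨⟨F, hF, hX⟩, hX'⟩ ⟨⟨G, hG, hY⟩, hY'⟩
    exact ⟨⟨fun x => F x + G x, hF.add hG, fun g => by simp [hX, hY]⟩,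
      fun g h => by simp [hX', hY']⟩
  zero_mem' := ⟨⟨fun _ => 0, contDiff_const, fun _ => by simp⟩, fun _ _ => by simp⟩
  smul_mem' := by
    rintro a X ⟨⟨F, hF, hX⟩, hX'⟩
    exact ⟨⟨fun x => a • F x, hF.const_smul a, fun g => by simp [hX]⟩, fun g h => by simp [hX']⟩

/-- The product `u X` of a function and a vector field. -/
def fmul {n : ℕ} (u : Smooth n) (X : VectorField n) : VectorField n :=
  ⟨fun g => (u : SO n ⧸ H n → ℝ) (g : SO n ⧸ H n) • X.1 g, by
    obtain ⟨u, F, hF, hu⟩ := u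
    obtain ⟨X, ⟨G, hG, hX⟩, hX'⟩ := X
    refine ⟨⟨fun x => F x • G x, hF.smul hG, fun g => by simp [hu, hX]⟩, fun g h => ?_⟩
    have hgh : ((g * (h : SO n) : SO n) : SO n ⧸ H n) = (g : SO n ⧸ H n) :=
      QuotientGroup.mk_mul_of_mem g h.2
    simp only [hgh, hX', map_smul]⟩

/-- The vector field `f X`, for an invariant affinor structure `f` and a vector field `X`. -/
def appF {n : ℕ} (f : Affinor n) (X : VectorField n) : VectorField n :=
  ⟨fun g => (f : Module.End ℝ (m n)) (X.1 g), by
    obtain ⟨f, hf⟩ := f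
    obtain ⟨X, ⟨F, hF, hX⟩, hX'⟩ := X
    refine ⟨?_, fun g h => ?_⟩
    · let i : m n →ₗ[ℝ] Mat n := (so n).toSubmodule.subtype ∘ₗ (m n).subtype
      have hi : Function.Injective i := Subtype.val_injective.comp Subtype.val_injective
      obtain ⟨p, hp⟩ := i.exists_leftInverse_of_injective (LinearMap.ker_eq_bot.2 hi)
      have hp' : ∀ x, p (i x) = x := fun x => LinearMap.congr_fun hp x
      have hL : ContDiff ℝ ∞ (i ∘ₗ f ∘ₗ p : Mat n →ₗ[ℝ] Mat n) :=
        (LinearMap.toContinuousLinearMap (i ∘ₗ f ∘ₗ p : Mat n →ₗ[ℝ] Mat n)).contDiff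
      refine ⟨fun x => (i ∘ₗ f ∘ₗ p) (F x), hL.comp hF, fun g => ?_⟩
      have : F g = i (X g) := (hX g).symm
      simp only [this, LinearMap.comp_apply, hp']
      rfl
    · rw [Affinor, Subalgebra.mem_centralizer_iff] at hf
      change f (X (g * (h : SO n))) = AdM h⁻¹ (f (X g))
      rw [hX']
      exact (LinearMap.congr_fun (hf _ ⟨h⁻¹, rfl⟩) (X g)).symm⟩

theorem exp_mem_orthogonal {n : ℕ} (X : so n) :
    NormedSpace.exp (X : Mat n) ∈ Matrix.orthogonalGroup (Idx n) ℝ := by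
  have hX := (LieAlgebra.Orthogonal.mem_so (Idx n) ℝ _).1 X.2
  rw [Matrix.mem_orthogonalGroup_iff, ← Matrix.exp_transpose, hX,
    ← Matrix.exp_add_of_commute _ _ (Commute.neg_right (Commute.refl (X : Mat n)))]
  simp

/-- The exponential map `so(n) → SO(n)`. -/
def expSO {n : ℕ} (X : so n) : SO n :=
  ⟨NormedSpace.exp (X : Mat n), by
    refine Matrix.mem_specialOrthogonalGroup_iff.2 ⟨exp_mem_orthogonal X, ?_⟩
    have h := Matrix.exp_add_of_commute _ _ (Commute.refl (((1 / 2 : ℝ) • X : so n) : Mat n))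
    have h2 : (((1 / 2 : ℝ) • X : so n) : Mat n) + (((1 / 2 : ℝ) • X : so n) : Mat n) = X := by
      change (1 / 2 : ℝ) • (X : Mat n) + (1 / 2 : ℝ) • (X : Mat n) = X
      rw [← add_smul]; norm_num
    have h3 := (Matrix.mem_orthogonalGroup_iff _ _).1 (exp_mem_orthogonal ((1 / 2 : ℝ) • X))
    have h4 := congrArg Matrix.det h3
    rw [Matrix.det_mul, Matrix.det_transpose, Matrix.det_one] at h4
    rw [← h2, h, Matrix.det_mul, h4]⟩

/-- The derivative of a function `ψ` along a vector field `X`. A function on `SO(n)/H` is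
represented by its pull-back `ψ` to `SO(n)`, and the derivative at `gH` is the derivative of `ψ`
along the curve `τ ↦ g exp(τ X(g))`. -/
def lieD {n : ℕ} (X : VectorField n) (ψ : SO n → ℝ) (g : SO n) : ℝ :=
  deriv (fun τ : ℝ => ψ (g * expSO (τ • (X.1 g : so n)))) 0

/-- The pull-back to `SO(n)` of a function on `SO(n)/H`. -/
def pull {n : ℕ} (u : Smooth n) (g : SO n) : ℝ := (u : SO n ⧸ H n → ℝ) (g : SO n ⧸ H n)

/-! ### The Levi-Civita connection -/

/-- `nab X Y = ∇_X Y` is the Levi-Civita connection of the invariant metric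
`c · (g₀|𝔪₁ + s g₀|𝔪₂ + t g₀|𝔪₃)` on `SO(n)/H`: an affine connection that is free of torsion,
`∇_X Y - ∇_Y X = [X, Y]`, and compatible with the metric. -/
structure IsLeviCivita {n : ℕ} (c s t : ℝ)
    (nab : VectorField n → VectorField n → VectorField n) : Prop where
  add_left : ∀ X X' Y, nab (X + X') Y = nab X Y + nab X' Y
  smul_left : ∀ (u : Smooth n) X Y, nab (fmul u X) Y = fmul u (nab X Y)
  add_right : ∀ X Y Y', nab X (Y + Y') = nab X Y + nab X Y'
  leibniz : ∀ X (u : Smooth n) (Y : VectorField n) (g : SO n),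
    (nab X (fmul u Y)).1 g =
      lieD X (pull u) g • Y.1 g + pull u g • (nab X Y).1 g
  torsion_free : ∀ X Y (u : Smooth n) (g : SO n),
    lieD (nab X Y - nab Y X) (pull u) g =
      lieD X (lieD Y (pull u)) g - lieD Y (lieD X (pull u)) g
  metric_compat : ∀ (X Y Z : VectorField n) (g : SO n),
    lieD X (fun a => metric c s t (Y.1 a) (Z.1 a)) g =
      metric c s t ((nab X Y).1 g) (Z.1 g)
        + metric c s t (Y.1 g) ((nab X Z).1 g)

/-! ### Classes of metric `f`-structures -/

/-- `(∇_X f) Y = ∇_X (f Y) - f (∇_X Y)`. -/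
def covD {n : ℕ} (nab : VectorField n → VectorField n → VectorField n) (f : Affinor n)
    (X Y : VectorField n) : VectorField n :=
  nab X (appF f Y) - appF f (nab X Y)

/-- The composition tensor `T(X, Y) = ¼ f((∇_{fX} f) fY - (∇_{f²X} f) f²Y)`. -/
def compT {n : ℕ} (nab : VectorField n → VectorField n → VectorField n) (f : Affinor n)
    (X Y : VectorField n) : VectorField n :=
  (1 / 4 : ℝ) • appF f (covD nab f (appF f X) (appF f Y)
    - covD nab f (appF f (appF f X)) (appF f (appF f Y)))

/-- Metric `f`-structures: `f³ + f = 0` and `⟨fX, Y⟩ + ⟨X, fY⟩ = 0`. -/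
def IsMetricF {n : ℕ} (c s t : ℝ) (f : Affinor n) : Prop :=
  f ^ 3 + f = 0 ∧ ∀ (X Y : VectorField n) (g : SO n),
    metric c s t ((appF f X).1 g) (Y.1 g)
      + metric c s t (X.1 g) ((appF f Y).1 g) = 0

/-- Killing `f`-structures: metric `f`-structures with `(∇_X f) X = 0`. -/
def IsKilling {n : ℕ} (c s t : ℝ) (nab : VectorField n → VectorField n → VectorField n)
    (f : Affinor n) : Prop :=
  IsMetricF c s t f ∧ ∀ X : VectorField n, covD nab f X X = 0

/-- Nearly Kähler `f`-structures: metric `f`-structures with `(∇_{fX} f) fX = 0`. -/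
def IsNKf {n : ℕ} (c s t : ℝ) (nab : VectorField n → VectorField n → VectorField n)
    (f : Affinor n) : Prop :=
  IsMetricF c s t f ∧ ∀ X : VectorField n, covD nab f (appF f X) (appF f X) = 0

/-- `G₁f`-structures: metric `f`-structures with `T(X, X) = 0`. -/
def IsG1f {n : ℕ} (c s t : ℝ) (nab : VectorField n → VectorField n → VectorField n)
    (f : Affinor n) : Prop :=
  IsMetricF c s t f ∧ ∀ X : VectorField n, compT nab f X X = 0

end

end FlagSO

open FlagSO

/-!
A vector field on `SO(n)/H` is an equivariant map `SO(n) → 𝔪`; differentiating it along the curves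
`τ ↦ g exp(τ x)`, `x ∈ 𝔪`, is the canonical connection (`canon`). Invariant affinor structures are
constant maps to `End 𝔪`, so they are parallel for it (`canon_appF`), and
`(∇_X f) Y = Λ(X, f Y) - f Λ(X, Y)` for the difference `Λ` of the Levi-Civita and the canonical
connection (`covD_apply`).

The difference is determined pointwise by two identities. Freeness of torsion, tested on the entries
of `g K gᵀ` for a single diagonal matrix `K` commuting with `H`, says that the part of `Λ` that is
skew in its arguments is `½ [X, Y]_𝔪` (`nab_sub_nab_swap`), and compatibility with the metric says
that `Λ(X, ·)` is skew-symmetric. An explicit bilinear map `lam` has both properties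
(`lam_sub_lam_swap`, `metric_lam`); it is the only one by the argument of the Koszul formula, because
the metric is definite and every vector of `𝔪` is the value of some vector field
(`exists_vectorField`). That gives `nab_eq`.

In the blocks `(a, b, c)` of `𝔪 = 𝔪₁ ⊕ 𝔪₂ ⊕ 𝔪₃` the metric is a weighted sum of squares, since the
Killing form of `so(n)` is `(n - 2) tr(XY)` (`killingForm_so`), and each canonical `f`-structure is
`(αJ, βJ, 0)` (`rot`), with `(α, β) = (1, -1), (0, -1), (1, 0), (1, 1)` for `f₁, f₂, f₃, f₄`. The
Killing and the nearly Kähler condition become polynomial equations in `α`, `β`, `s`, `t`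
(`killing_condition`, `nearlyKahler_condition`). The `G₁` condition is automatic: `Λ` maps pairs from
`𝔪₁ ⊕ 𝔪₂` into `𝔪₃`, which `f` annihilates (`rot_lam_rot_rot`).
-/

namespace FlagSO

noncomputable section

variable {n : ℕ}

/-! ### The Killing form of `so(n)` -/

theorem trace_mul_left_right {ι : Type*} [Fintype ι] [DecidableEq ι] (A C : Matrix ι ι ℝ) :
    LinearMap.trace ℝ (Matrix ι ι ℝ) (LinearMap.mulLeft ℝ A ∘ₗ LinearMap.mulRight ℝ C)
      = A.trace * C.trace := by
  rw [LinearMap.trace_eq_matrix_trace ℝ (Matrix.stdBasis ℝ ι ι), Matrix.trace,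
    Fintype.sum_prod_type, Matrix.trace, Matrix.trace, Finset.sum_mul_sum]
  refine Finset.sum_congr rfl fun i _ => Finset.sum_congr rfl fun j _ => ?_
  rw [Matrix.diag_apply, LinearMap.toMatrix_apply, Matrix.stdBasis_eq_single]
  have h (Z : Matrix ι ι ℝ) : (Matrix.stdBasis ℝ ι ι).repr Z (i, j) = Z i j := by
    simp [Matrix.stdBasis]
  rw [h]
  simp [Matrix.mul_apply, Matrix.single_apply, Finset.sum_ite_eq, ite_and]

theorem trace_mul_transpose_mul {ι : Type*} [Fintype ι] [DecidableEq ι] (A C : Matrix ι ι ℝ) :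
    LinearMap.trace ℝ (Matrix ι ι ℝ) (LinearMap.mulLeft ℝ A ∘ₗ LinearMap.mulRight ℝ C ∘ₗ
      (Matrix.transposeLinearEquiv ι ι ℝ ℝ : Matrix ι ι ℝ →ₗ[ℝ] Matrix ι ι ℝ))
      = (A * Cᵀ).trace := by
  rw [LinearMap.trace_eq_matrix_trace ℝ (Matrix.stdBasis ℝ ι ι), Matrix.trace,
    Fintype.sum_prod_type, Matrix.trace]
  refine Finset.sum_congr rfl fun i _ => ?_
  rw [Matrix.diag_apply, Matrix.mul_apply]
  refine Finset.sum_congr rfl fun j _ => ?_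
  rw [Matrix.diag_apply, LinearMap.toMatrix_apply, Matrix.stdBasis_eq_single]
  have h (Z : Matrix ι ι ℝ) : (Matrix.stdBasis ℝ ι ι).repr Z (i, j) = Z i j := by
    simp [Matrix.stdBasis]
  rw [h]
  simp [Matrix.mul_apply, Matrix.single_apply, Finset.sum_ite_eq, ite_and]

/-- The projection of a matrix to its skew-symmetric part. -/
def skewPart {ι : Type*} [Fintype ι] [DecidableEq ι] :
    Matrix ι ι ℝ →ₗ[ℝ] LieAlgebra.Orthogonal.so ι ℝ where
  toFun Z := ⟨(1 / 2 : ℝ) • (Z - Zᵀ), by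
    rw [LieAlgebra.Orthogonal.mem_so]
    simp [Matrix.transpose_smul, Matrix.transpose_sub, ← smul_neg]⟩
  map_add' Z W := by ext1; simp [← smul_add]; abel
  map_smul' r Z := by ext1; simp [smul_comm r, smul_sub]

theorem skewPart_coe {ι : Type*} [Fintype ι] [DecidableEq ι] (Z : LieAlgebra.Orthogonal.so ι ℝ) :
    skewPart (Z : Matrix ι ι ℝ) = Z := by
  apply Subtype.ext
  have hZ := (LieAlgebra.Orthogonal.mem_so ι ℝ _).1 Z.2
  change (1 / 2 : ℝ) • ((Z : Matrix ι ι ℝ) - (Z : Matrix ι ι ℝ)ᵀ) = Z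
  rw [hZ, sub_neg_eq_add, ← two_smul ℝ, smul_smul]
  norm_num

/-- The Killing form of `so(n)` is `(n - 2) tr(XY)`: the trace over `so(n)` of an endomorphism that
extends to all matrices is the trace over all matrices of the extension precomposed with the
projection to the skew-symmetric part. -/
theorem killingForm_so {ι : Type*} [Fintype ι] [DecidableEq ι]
    (X Y : LieAlgebra.Orthogonal.so ι ℝ) :
    killingForm ℝ (LieAlgebra.Orthogonal.so ι ℝ) X Y
      = ((Fintype.card ι : ℝ) - 2) * ((X : Matrix ι ι ℝ) * (Y : Matrix ι ι ℝ)).trace := by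
  set x : Matrix ι ι ℝ := X.1
  set y : Matrix ι ι ℝ := Y.1
  have hX : xᵀ = -x := (LieAlgebra.Orthogonal.mem_so ι ℝ _).1 X.2
  have hY : yᵀ = -y := (LieAlgebra.Orthogonal.mem_so ι ℝ _).1 Y.2
  have htx : x.trace = 0 := by
    have := Matrix.trace_transpose x
    rw [hX, Matrix.trace_neg] at this
    linarith
  have hty : y.trace = 0 := by
    have := Matrix.trace_transpose y
    rw [hY, Matrix.trace_neg] at this
    linarith
  let i : LieAlgebra.Orthogonal.so ι ℝ →ₗ[ℝ] Matrix ι ι ℝ :=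
    (LieAlgebra.Orthogonal.so ι ℝ).toSubmodule.subtype
  have hpi : skewPart ∘ₗ i = LinearMap.id := by
    ext1 Z
    exact skewPart_coe Z
  rw [killingForm_apply_apply]
  have h1 : LinearMap.trace ℝ _ (LieAlgebra.ad ℝ (LieAlgebra.Orthogonal.so ι ℝ) X ∘ₗ
      LieAlgebra.ad ℝ (LieAlgebra.Orthogonal.so ι ℝ) Y)
      = LinearMap.trace ℝ _ (i ∘ₗ (LieAlgebra.ad ℝ (LieAlgebra.Orthogonal.so ι ℝ) X ∘ₗ
      LieAlgebra.ad ℝ (LieAlgebra.Orthogonal.so ι ℝ) Y) ∘ₗ skewPart) := by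
    conv_rhs => rw [LinearMap.trace_comp_comm', LinearMap.comp_assoc, hpi, LinearMap.comp_id]
  let τ : Matrix ι ι ℝ →ₗ[ℝ] Matrix ι ι ℝ := Matrix.transposeLinearEquiv ι ι ℝ ℝ
  have hτ (Z : Matrix ι ι ℝ) : τ Z = Zᵀ := rfl
  let M (A C : Matrix ι ι ℝ) : Matrix ι ι ℝ →ₗ[ℝ] Matrix ι ι ℝ :=
    LinearMap.mulLeft ℝ A ∘ₗ LinearMap.mulRight ℝ C
  have h2 : (i ∘ₗ (LieAlgebra.ad ℝ (LieAlgebra.Orthogonal.so ι ℝ) X ∘ₗ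
      LieAlgebra.ad ℝ (LieAlgebra.Orthogonal.so ι ℝ) Y) ∘ₗ skewPart)
      = (1 / 2 : ℝ) • ((M (x * y) 1 - M x y - M y x + M 1 (y * x))
        - (M (x * y) 1 ∘ₗ τ - M x y ∘ₗ τ - M y x ∘ₗ τ + M 1 (y * x) ∘ₗ τ)) := by
    ext1 Z
    change ⁅x, ⁅y, (1 / 2 : ℝ) • (Z - Zᵀ)⁆⁆ = _
    simp only [M, hτ, LinearMap.smul_apply, LinearMap.sub_apply, LinearMap.add_apply,
      LinearMap.comp_apply, LinearMap.mulLeft_apply, LinearMap.mulRight_apply, Ring.lie_def,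
      mul_one, one_mul]
    simp only [Matrix.mul_smul, Matrix.smul_mul, ← smul_sub]
    congr 1
    noncomm_ring
  have e1 (A C : Matrix ι ι ℝ) : LinearMap.trace ℝ _ (M A C) = A.trace * C.trace :=
    trace_mul_left_right A C
  have e2 (A C : Matrix ι ι ℝ) : LinearMap.trace ℝ _ (M A C ∘ₗ τ) = (A * Cᵀ).trace := by
    rw [← trace_mul_transpose_mul, LinearMap.comp_assoc]
  rw [h1, h2]
  simp only [map_smul, map_sub, map_add, e1, e2, smul_eq_mul, Matrix.transpose_mul,
    Matrix.transpose_one, hX, hY, htx, hty, Matrix.trace_one, mul_one, one_mul, mul_neg, neg_mul,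
    Matrix.trace_neg, neg_neg, Matrix.trace_mul_comm y x]
  ring

theorem killingForm_so_eq_sum {ι : Type*} [Fintype ι] [DecidableEq ι]
    (X Y : LieAlgebra.Orthogonal.so ι ℝ) :
    -killingForm ℝ (LieAlgebra.Orthogonal.so ι ℝ) X Y
      = ((Fintype.card ι : ℝ) - 2) *
        ∑ i, ∑ j, (X : Matrix ι ι ℝ) i j * (Y : Matrix ι ι ℝ) i j := by
  have hY (i j) : (Y : Matrix ι ι ℝ) j i = -(Y : Matrix ι ι ℝ) i j :=
    congrFun (congrFun ((LieAlgebra.Orthogonal.mem_so ι ℝ _).1 Y.2) i) j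
  have h : ((X : Matrix ι ι ℝ) * (Y : Matrix ι ι ℝ)).trace
      = -∑ i, ∑ j, (X : Matrix ι ι ℝ) i j * (Y : Matrix ι ι ℝ) i j := by
    simp only [Matrix.trace, Matrix.diag_apply, Matrix.mul_apply, ← Finset.sum_neg_distrib]
    refine Finset.sum_congr rfl fun i _ => Finset.sum_congr rfl fun j _ => ?_
    rw [hY i j, mul_neg]
  rw [killingForm_so, h]
  ring

/-! ### Block coordinates on the reductive complement -/

theorem so_apply_swap (X : so n) (i j : Idx n) : (X : Mat n) j i = -(X : Mat n) i j :=
  congrFun (congrFun ((LieAlgebra.Orthogonal.mem_so (Idx n) ℝ _).1 X.2) i) j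

/-- The `1 × 2` block of a skew-symmetric matrix. -/
def coordA : so n →ₗ[ℝ] (Fin 2 → ℝ) where
  toFun X i := (X : Mat n) (.inl 0) (.inr (.inl i))
  map_add' _ _ := rfl
  map_smul' _ _ := rfl

/-- The `2 × (n-3)` block of a skew-symmetric matrix. -/
def coordB : so n →ₗ[ℝ] (Fin 2 → Fin (n - 3) → ℝ) where
  toFun X i j := (X : Mat n) (.inr (.inl i)) (.inr (.inr j))
  map_add' _ _ := rfl
  map_smul' _ _ := rfl

/-- The `1 × (n-3)` block of a skew-symmetric matrix. -/
def coordC : so n →ₗ[ℝ] (Fin (n - 3) → ℝ) where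
  toFun X j := (X : Mat n) (.inl 0) (.inr (.inr j))
  map_add' _ _ := rfl
  map_smul' _ _ := rfl

theorem coordA_apply (X : so n) (i) : coordA X i = (X : Mat n) (.inl 0) (.inr (.inl i)) := rfl

theorem coordB_apply (X : so n) (i j) :
    coordB X i j = (X : Mat n) (.inr (.inl i)) (.inr (.inr j)) := rfl

theorem coordC_apply (X : so n) (j) : coordC X j = (X : Mat n) (.inl 0) (.inr (.inr j)) := rfl

/-- The skew-symmetric matrix with prescribed off-diagonal blocks and zero diagonal blocks. -/
def ofCoords (a : Fin 2 → ℝ) (b : Fin 2 → Fin (n - 3) → ℝ) (c : Fin (n - 3) → ℝ) : so n :=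
  ⟨Matrix.fromBlocks 0 (Matrix.of fun _ => Sum.elim a c) (Matrix.of fun i _ => -Sum.elim a c i)
      (Matrix.fromBlocks 0 (Matrix.of b) (-(Matrix.of b)ᵀ) 0), by
    rw [LieAlgebra.Orthogonal.mem_so]
    ext (i | i | i) (j | j | j) <;> simp⟩

section ofCoords

variable (a : Fin 2 → ℝ) (b : Fin 2 → Fin (n - 3) → ℝ) (c : Fin (n - 3) → ℝ)

@[simp] theorem coordA_ofCoords : coordA (ofCoords a b c) = a := rfl

@[simp] theorem coordB_ofCoords : coordB (ofCoords a b c) = b := rfl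

@[simp] theorem coordC_ofCoords : coordC (ofCoords a b c) = c := rfl

end ofCoords

theorem eq_ofCoords_of_diag {X : so n} (h1 : ∀ i j, (X : Mat n) (.inr (.inl i)) (.inr (.inl j)) = 0)
    (h2 : ∀ i j, (X : Mat n) (.inr (.inr i)) (.inr (.inr j)) = 0) :
    X = ofCoords (coordA X) (coordB X) (coordC X) := by
  apply Subtype.ext
  ext (i | i | i) (j | j | j)
  · have := so_apply_swap X (.inl i) (.inl j)
    obtain rfl := Subsingleton.elim i j
    simp only [ofCoords, Matrix.fromBlocks_apply₁₁, Matrix.zero_apply]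
    linarith
  · obtain rfl := Subsingleton.elim i 0
    rfl
  · obtain rfl := Subsingleton.elim i 0
    rfl
  · obtain rfl := Subsingleton.elim j 0
    exact so_apply_swap X _ _
  · exact h1 i j
  · rfl
  · obtain rfl := Subsingleton.elim j 0
    exact so_apply_swap X _ _
  · exact so_apply_swap X _ _
  · exact h2 i j

theorem coordA_phi_zero (X : so n) :
    coordA (phi n X) 0 = 1 / 2 * coordA X 0 + √3 / 2 * coordA X 1 := by
  simp [coordA_apply, phi, B, blockDiag, Matrix.mul_apply, Fintype.sum_sum_type, Matrix.one_apply]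
  ring

theorem coordA_phi_one (X : so n) :
    coordA (phi n X) 1 = -(√3 / 2) * coordA X 0 + 1 / 2 * coordA X 1 := by
  simp [coordA_apply, phi, B, blockDiag, Matrix.mul_apply, Fintype.sum_sum_type, Matrix.one_apply]
  ring

theorem coordB_phi_zero (X : so n) (j) :
    coordB (phi n X) 0 j = -(1 / 2) * coordB X 0 j - √3 / 2 * coordB X 1 j := by
  simp [coordB_apply, phi, B, blockDiag, Matrix.mul_apply, Fintype.sum_sum_type, Matrix.one_apply]
  ring

theorem coordB_phi_one (X : so n) (j) :
    coordB (phi n X) 1 j = √3 / 2 * coordB X 0 j - 1 / 2 * coordB X 1 j := by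
  simp [coordB_apply, phi, B, blockDiag, Matrix.mul_apply, Fintype.sum_sum_type, Matrix.one_apply]
  ring

theorem coordC_phi (X : so n) (j) : coordC (phi n X) j = -coordC X j := by
  simp [coordC_apply, phi, B, blockDiag, Matrix.mul_apply, Fintype.sum_sum_type, Matrix.one_apply]

theorem sqrt_three_mul : √3 * √3 = (3 : ℝ) := Real.mul_self_sqrt (by norm_num)

theorem phi_apply_diag_two (X : so n) (i j : Fin 2) :
    (phi n X : Mat n) (.inr (.inl i)) (.inr (.inl j)) =
      (X : Mat n) (.inr (.inl i)) (.inr (.inl j)) := by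
  have h3 := sqrt_three_mul
  have h00 := so_apply_swap X (.inr (.inl 0)) (.inr (.inl 0))
  have h01 := so_apply_swap X (.inr (.inl 0)) (.inr (.inl 1))
  have h11 := so_apply_swap X (.inr (.inl 1)) (.inr (.inl 1))
  have h00' : (X : Mat n) (.inr (.inl 0)) (.inr (.inl 0)) = 0 := by linarith
  have h11' : (X : Mat n) (.inr (.inl 1)) (.inr (.inl 1)) = 0 := by linarith
  fin_cases i <;> fin_cases j <;>
    simp [phi, B, blockDiag, Matrix.mul_apply, Fintype.sum_sum_type, h00', h11', h01]
  · ring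
  · linear_combination ((X : Mat n) (.inr (.inl 0)) (.inr (.inl 1)) / 4) * h3
  · linear_combination (-(X : Mat n) (.inr (.inl 0)) (.inr (.inl 1)) / 4) * h3
  · ring

theorem phi_apply_diag_three (X : so n) (i j : Fin (n - 3)) :
    (phi n X : Mat n) (.inr (.inr i)) (.inr (.inr j)) =
      (X : Mat n) (.inr (.inr i)) (.inr (.inr j)) := by
  simp [phi, B, blockDiag, Matrix.mul_apply, Fintype.sum_sum_type, Matrix.one_apply]

theorem eq_ofCoords_of_mem_m {X : so n} (hX : X ∈ m n) :
    X = ofCoords (coordA X) (coordB X) (coordC X) := by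
  obtain ⟨Z, rfl⟩ := hX
  apply eq_ofCoords_of_diag
  · exact fun i j => sub_eq_zero.2 (phi_apply_diag_two Z i j)
  · exact fun i j => sub_eq_zero.2 (phi_apply_diag_three Z i j)

theorem ofCoords_mem_m (a : Fin 2 → ℝ) (b : Fin 2 → Fin (n - 3) → ℝ) (c : Fin (n - 3) → ℝ) :
    ofCoords a b c ∈ m n := by
  have h3 := sqrt_three_mul
  -- With `R` the rotation by `-π/3`, `R² - R + 1 = 0` yields `(R - 1)⁻¹ = -R` and
  -- `(-R - 1)⁻¹ = (R - 2) / 3`.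
  let Z : so n := ofCoords
    ![-(1 / 2 * a 0 + √3 / 2 * a 1), -(-(√3 / 2) * a 0 + 1 / 2 * a 1)]
    ![fun j => (-(3 / 2) * b 0 j + √3 / 2 * b 1 j) / 3,
      fun j => (-(√3 / 2) * b 0 j - 3 / 2 * b 1 j) / 3]
    (fun j => -(1 / 2) * c j)
  have hZ : phi n Z - Z ∈ m n := ⟨Z, rfl⟩
  convert hZ using 1
  rw [eq_ofCoords_of_mem_m hZ]
  congr 1
  · ext i
    fin_cases i
    · simp [coordA_phi_zero, Z]
      linear_combination (-(a 0) / 4) * h3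
    · simp [coordA_phi_one, Z]
      linear_combination (-(a 1) / 4) * h3
  · ext i j
    fin_cases i
    · simp [coordB_phi_zero, Z]
      linear_combination (-(b 0 j) / 12) * h3
    · simp [coordB_phi_one, Z]
      linear_combination (-(b 1 j) / 12) * h3
  · ext j
    simp [coordC_phi, Z]
    ring

theorem m_ext {x y : m n} (ha : coordA (x : so n) = coordA (y : so n))
    (hb : coordB (x : so n) = coordB (y : so n)) (hc : coordC (x : so n) = coordC (y : so n)) :
    x = y := by
  apply Subtype.ext
  rw [eq_ofCoords_of_mem_m x.2, eq_ofCoords_of_mem_m y.2, ha, hb, hc]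

/-- The projection of `so(n)` to `𝔪` along the block-diagonal matrices. -/
def projM : so n →ₗ[ℝ] m n where
  toFun X := ⟨ofCoords (coordA X) (coordB X) (coordC X), ofCoords_mem_m _ _ _⟩
  map_add' X Y := by apply m_ext <;> simp
  map_smul' r X := by apply m_ext <;> simp

@[simp] theorem coordA_projM (X : so n) : coordA (projM X : so n) = coordA X := rfl

@[simp] theorem coordB_projM (X : so n) : coordB (projM X : so n) = coordB X := rfl

@[simp] theorem coordC_projM (X : so n) : coordC (projM X : so n) = coordC X := rfl

theorem projM_coe (x : m n) : projM (x : so n) = x := m_ext rfl rfl rfl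

/-- The kernel of the projection to `𝔪` is the fixed space of `φ`. -/
theorem projM_eq_zero_iff_phi (X : so n) : projM X = 0 ↔ phi n X = X := by
  have h3 := sqrt_three_mul
  constructor
  · intro h
    have ha : coordA X = 0 := by rw [← coordA_projM, h]; simp
    have hb : coordB X = 0 := by rw [← coordB_projM, h]; simp
    have hc : coordC X = 0 := by rw [← coordC_projM, h]; simp
    have hm : phi n X - X ∈ m n := ⟨X, rfl⟩
    have : (⟨phi n X - X, hm⟩ : m n) = 0 := by
      apply m_ext
      · ext i; fin_cases i <;> simp [coordA_phi_zero, coordA_phi_one, ha]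
      · ext i j; fin_cases i <;> simp [coordB_phi_zero, coordB_phi_one, hb]
      · ext j; simp [coordC_phi, hc]
    exact sub_eq_zero.1 (congrArg Subtype.val this)
  · intro h
    apply m_ext
    · have h0 := coordA_phi_zero X
      have h1 := coordA_phi_one X
      rw [h] at h0 h1
      ext i
      fin_cases i
      · simp
        linear_combination (1 / 2) * h0 + (√3 / 2) * h1 - (coordA X 0 / 4) * h3
      · simp
        linear_combination (1 / 2) * h1 - (√3 / 2) * h0 - (coordA X 1 / 4) * h3
    · ext i j
      have h0 := coordB_phi_zero X j
      have h1 := coordB_phi_one X j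
      rw [h] at h0 h1
      fin_cases i
      · simp
        linear_combination (1 / 2) * h0 - (√3 / 6) * h1 - (coordB X 0 j / 12) * h3
      · simp
        linear_combination (1 / 2) * h1 + (√3 / 6) * h0 - (coordB X 1 j / 12) * h3
    · ext j
      have h0 := coordC_phi X j
      rw [h] at h0
      simp
      linarith

theorem projM_Ad (h : H n) (X : so n) : projM (Ad (h : SO n) X) = AdM h (projM X) := by
  -- The block-diagonal part of `X` is fixed by `φ`, and so is its image under `Ad(h)`.
  have h1 : projM (X - (projM X : so n)) = 0 := by rw [map_sub, projM_coe, sub_self]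
  have h2 : projM (Ad (h : SO n) (X - (projM X : so n))) = 0 := by
    rw [projM_eq_zero_iff_phi] at h1 ⊢
    rw [phi_Ad, h1]
  rw [map_sub, map_sub, sub_eq_zero] at h2
  rw [h2]
  exact projM_coe (AdM h (projM X))

/-- The element of `𝔪` with prescribed blocks. -/
def mkM (a : Fin 2 → ℝ) (b : Fin 2 → Fin (n - 3) → ℝ) (c : Fin (n - 3) → ℝ) : m n :=
  ⟨ofCoords a b c, ofCoords_mem_m a b c⟩

section mkM

variable (a : Fin 2 → ℝ) (b : Fin 2 → Fin (n - 3) → ℝ) (c : Fin (n - 3) → ℝ)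

@[simp] theorem coordA_mkM : coordA (mkM a b c : so n) = a := rfl

@[simp] theorem coordB_mkM : coordB (mkM a b c : so n) = b := rfl

@[simp] theorem coordC_mkM : coordC (mkM a b c : so n) = c := rfl

end mkM

/-! ### The canonical `f`-structures in block coordinates -/

/-- The endomorphism `(αJ, βJ, 0)` of `𝔪 = 𝔪₁ ⊕ 𝔪₂ ⊕ 𝔪₃`, where `J = !![0, 1; -1, 0]` acts on the
factor `ℝ²` of the blocks of sizes `1 × 2` and `2 × (n-3)`. -/
def rot (α β : ℝ) : Module.End ℝ (m n) where
  toFun x := mkM ![α * coordA (x : so n) 1, -(α * coordA (x : so n) 0)]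
    ![fun j => β * coordB (x : so n) 1 j, fun j => -(β * coordB (x : so n) 0 j)] 0
  map_add' x y := by
    apply m_ext
    · ext i; fin_cases i <;> simp <;> ring
    · ext i j; fin_cases i <;> simp <;> ring
    · simp
  map_smul' r x := by
    apply m_ext
    · ext i; fin_cases i <;> simp <;> ring
    · ext i j; fin_cases i <;> simp <;> ring
    · simp

section rot

variable (α β : ℝ) (x : m n)

@[simp] theorem coordA_rot_zero : coordA (rot α β x : so n) 0 = α * coordA (x : so n) 1 := rfl

@[simp] theorem coordA_rot_one : coordA (rot α β x : so n) 1 = -(α * coordA (x : so n) 0) := rfl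

@[simp] theorem coordB_rot_zero (j) :
    coordB (rot α β x : so n) 0 j = β * coordB (x : so n) 1 j := rfl

@[simp] theorem coordB_rot_one (j) :
    coordB (rot α β x : so n) 1 j = -(β * coordB (x : so n) 0 j) := rfl

@[simp] theorem coordC_rot : coordC (rot α β x : so n) = 0 := rfl

end rot

theorem coe_theta (x : m n) : (theta n x : so n) = phi n x := rfl

theorem phi_sq_coords (X : so n) :
    coordA (phi n (phi n X)) 0 = -(1 / 2) * coordA X 0 + √3 / 2 * coordA X 1 ∧
    coordA (phi n (phi n X)) 1 = -(√3 / 2) * coordA X 0 - 1 / 2 * coordA X 1 ∧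
    (∀ j, coordB (phi n (phi n X)) 0 j = -(1 / 2) * coordB X 0 j + √3 / 2 * coordB X 1 j) ∧
    (∀ j, coordB (phi n (phi n X)) 1 j = -(√3 / 2) * coordB X 0 j - 1 / 2 * coordB X 1 j) ∧
    ∀ j, coordC (phi n (phi n X)) j = coordC X j := by
  have h3 := sqrt_three_mul
  simp only [coordA_phi_zero, coordA_phi_one, coordB_phi_zero, coordB_phi_one, coordC_phi]
  refine ⟨?_, ?_, fun j => ?_, fun j => ?_, fun j => ?_⟩
  · linear_combination (-(coordA X 0) / 4) * h3
  · linear_combination (-(coordA X 1) / 4) * h3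
  · linear_combination (-(coordB X 0 j) / 4) * h3
  · linear_combination (-(coordB X 1 j) / 4) * h3
  · ring

/-- `φ³` acts on `𝔪₁`, `𝔪₂`, `𝔪₃` as `-1`, `1`, `-1`, which reduces `θ⁴` and `θ⁵` to `θ` and `θ²`. -/
theorem phi_cube_coords (X : so n) :
    coordA (phi n (phi n (phi n X))) = -coordA X ∧ coordB (phi n (phi n (phi n X))) = coordB X ∧
      coordC (phi n (phi n (phi n X))) = -coordC X := by
  have h3 := sqrt_three_mul
  obtain ⟨h1, h2, h4, h5, h6⟩ := phi_sq_coords (phi n X)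
  refine ⟨?_, ?_, ?_⟩
  · ext i
    fin_cases i
    · simp [h1, coordA_phi_zero, coordA_phi_one]
      linear_combination (-(coordA X 0) / 4) * h3
    · simp [h2, coordA_phi_zero, coordA_phi_one]
      linear_combination (-(coordA X 1) / 4) * h3
  · ext i j
    fin_cases i
    · simp [h4, coordB_phi_zero, coordB_phi_one]
      linear_combination ((coordB X 0 j) / 4) * h3
    · simp [h5, coordB_phi_zero, coordB_phi_one]
      linear_combination ((coordB X 1 j) / 4) * h3
  · ext j
    simp [h6, coordC_phi]

theorem coordA_theta_pow_four (x : m n) :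
    coordA ((theta n ^ 4) x : so n) = -coordA (theta n x : so n) :=
  (phi_cube_coords (phi n x)).1

theorem coordB_theta_pow_four (x : m n) :
    coordB ((theta n ^ 4) x : so n) = coordB (theta n x : so n) :=
  (phi_cube_coords (phi n x)).2.1

theorem coordC_theta_pow_four (x : m n) :
    coordC ((theta n ^ 4) x : so n) = -coordC (theta n x : so n) :=
  (phi_cube_coords (phi n x)).2.2

theorem coordA_theta_pow_five (x : m n) :
    coordA ((theta n ^ 5) x : so n) = -coordA ((theta n ^ 2) x : so n) :=
  (phi_cube_coords (phi n (phi n x))).1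

theorem coordB_theta_pow_five (x : m n) :
    coordB ((theta n ^ 5) x : so n) = coordB ((theta n ^ 2) x : so n) :=
  (phi_cube_coords (phi n (phi n x))).2.1

theorem coordC_theta_pow_five (x : m n) :
    coordC ((theta n ^ 5) x : so n) = -coordC ((theta n ^ 2) x : so n) :=
  (phi_cube_coords (phi n (phi n x))).2.2

theorem theta_sub_pow_five : (1 / √3) • (theta n - theta n ^ 5) = rot 1 (-1) := by
  have h3 : √3 ≠ (0 : ℝ) := by positivity
  ext1 x
  obtain ⟨h1, h2, h4, h5, h6⟩ := phi_sq_coords (x : so n)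
  replace h1 : coordA ((theta n ^ 2) x : so n) 0 = _ := h1
  replace h2 : coordA ((theta n ^ 2) x : so n) 1 = _ := h2
  replace h4 : ∀ j, coordB ((theta n ^ 2) x : so n) 0 j = _ := h4
  replace h5 : ∀ j, coordB ((theta n ^ 2) x : so n) 1 j = _ := h5
  replace h6 : ∀ j, coordC ((theta n ^ 2) x : so n) j = _ := h6
  apply m_ext
  · ext i
    fin_cases i
    · simp [coordA_theta_pow_five, h1, coe_theta, coordA_phi_zero]
      field_simp
      ring
    · simp [coordA_theta_pow_five, h2, coe_theta, coordA_phi_one]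
      field_simp
      ring
  · ext i j
    fin_cases i
    · simp [coordB_theta_pow_five, h4, coe_theta, coordB_phi_zero]
      field_simp
      ring
    · simp [coordB_theta_pow_five, h5, coe_theta, coordB_phi_one]
      field_simp
      ring
  · ext j
    simp [coordC_theta_pow_five, h6, coe_theta, coordC_phi]

theorem theta_sq_sub_pow_four : (1 / √3) • (theta n ^ 2 - theta n ^ 4) = rot 1 1 := by
  have h3 : √3 ≠ (0 : ℝ) := by positivity
  ext1 x
  obtain ⟨h1, h2, h4, h5, h6⟩ := phi_sq_coords (x : so n)
  replace h1 : coordA ((theta n ^ 2) x : so n) 0 = _ := h1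
  replace h2 : coordA ((theta n ^ 2) x : so n) 1 = _ := h2
  replace h4 : ∀ j, coordB ((theta n ^ 2) x : so n) 0 j = _ := h4
  replace h5 : ∀ j, coordB ((theta n ^ 2) x : so n) 1 j = _ := h5
  replace h6 : ∀ j, coordC ((theta n ^ 2) x : so n) j = _ := h6
  apply m_ext
  · ext i
    fin_cases i
    · simp [coordA_theta_pow_four, h1, coe_theta, coordA_phi_zero]
      field_simp
      ring
    · simp [coordA_theta_pow_four, h2, coe_theta, coordA_phi_one]
      field_simp
      ring
  · ext i j
    fin_cases i
    · simp [coordB_theta_pow_four, h4, coe_theta, coordB_phi_zero]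
      field_simp
      ring
    · simp [coordB_theta_pow_four, h5, coe_theta, coordB_phi_one]
      field_simp
      ring
  · ext j
    simp [coordC_theta_pow_four, h6, coe_theta, coordC_phi]

theorem smul_rot_add_rot (α β α' β' r : ℝ) :
    r • (rot α β + rot α' β' : Module.End ℝ (m n)) = rot (r * (α + α')) (r * (β + β')) := by
  ext1 x
  apply m_ext
  · ext i; fin_cases i <;> simp <;> ring
  · ext i j; fin_cases i <;> simp <;> ring
  · simp

theorem coe_f₁ : (f₁ n : Module.End ℝ (m n)) = rot 1 (-1) := theta_sub_pow_five

theorem coe_f₄ : (f₄ n : Module.End ℝ (m n)) = rot 1 1 := theta_sq_sub_pow_four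

theorem coe_f₂ : (f₂ n : Module.End ℝ (m n)) = rot 0 (-1) := by
  have h : (f₂ n : Module.End ℝ (m n)) = (1 / 2 : ℝ) • ((1 / √3) • (theta n - theta n ^ 5)
      + (-1 : ℝ) • ((1 / √3) • (theta n ^ 2 - theta n ^ 4))) := by
    change (1 / (2 * √3)) • (theta n - theta n ^ 2 + theta n ^ 4 - theta n ^ 5) = _
    rw [smul_comm (-1 : ℝ), ← smul_add, smul_smul]
    congr 1
    · ring
    · module
  rw [h, theta_sub_pow_five, theta_sq_sub_pow_four]
  ext1 x
  apply m_ext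
  · ext i; fin_cases i <;> simp
  · ext i j; fin_cases i <;> simp <;> ring
  · simp

theorem coe_f₃ : (f₃ n : Module.End ℝ (m n)) = rot 1 0 := by
  have h : (f₃ n : Module.End ℝ (m n)) = (1 / 2 : ℝ) • ((1 / √3) • (theta n - theta n ^ 5)
      + ((1 / √3) • (theta n ^ 2 - theta n ^ 4))) := by
    change (1 / (2 * √3)) • (theta n + theta n ^ 2 - theta n ^ 4 - theta n ^ 5) = _
    rw [← smul_add, smul_smul]
    congr 1
    · ring
    · abel
  rw [h, theta_sub_pow_five, theta_sq_sub_pow_four, smul_rot_add_rot]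
  norm_num

/-! ### The invariant metrics in block coordinates -/

theorem coe_part_apply (p q : Fin 3) (X : so n) (i j : Idx n) :
    (part p q X : Mat n) i j =
      if (blk i = p ∧ blk j = q) ∨ (blk i = q ∧ blk j = p) then (X : Mat n) i j else 0 := rfl

theorem metric_eq (hn : 4 ≤ n) (c s t : ℝ) (x y : m n) :
    metric c s t x y = c * (2 * (n - 2)) *
      (∑ i, coordA (x : so n) i * coordA (y : so n) i
        + s * ∑ j, ∑ i, coordB (x : so n) i j * coordB (y : so n) i j
        + t * ∑ j, coordC (x : so n) j * coordC (y : so n) j) := by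
  have hcard : (Fintype.card (Idx n) : ℝ) = n := by
    have : Fintype.card (Idx n) = n := by simp; omega
    rw [this]
  have e (X Y : so n) : g₀ X Y = ((n : ℝ) - 2) *
        ∑ i, ∑ j, (X : Mat n) i j * (Y : Mat n) i j := by
    rw [g₀, killingForm_so_eq_sum, hcard]
  have hA : g₀ (part 0 1 (x : so n)) (part 0 1 (y : so n))
      = (n - 2) * (2 * ∑ i, coordA (x : so n) i * coordA (y : so n) i) := by
    rw [e]
    congr 1
    simp only [coe_part_apply, blk, Fintype.sum_sum_type, Fin.sum_univ_two, Fin.sum_univ_one]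
    simp [so_apply_swap _ (.inl 0) (.inr _), coordA_apply]
    ring
  have hB : g₀ (part 1 2 (x : so n)) (part 1 2 (y : so n))
      = (n - 2) * (2 * ∑ j, ∑ i, coordB (x : so n) i j * coordB (y : so n) i j) := by
    rw [e]
    congr 1
    simp only [coe_part_apply, blk, Fintype.sum_sum_type, Fin.sum_univ_two, Fin.sum_univ_one]
    simp [so_apply_swap _ (.inr (.inl _)) (.inr (.inr _)), coordB_apply, Finset.sum_add_distrib]
    ring
  have hC : g₀ (part 0 2 (x : so n)) (part 0 2 (y : so n))
      = (n - 2) * (2 * ∑ j, coordC (x : so n) j * coordC (y : so n) j) := by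
    rw [e]
    congr 1
    simp only [coe_part_apply, blk, Fintype.sum_sum_type, Fin.sum_univ_two, Fin.sum_univ_one]
    simp [so_apply_swap _ (.inl 0) (.inr _), coordC_apply]
    ring
  rw [metric, hA, hB, hC]
  ring

theorem eq_zero_of_metric_self (hn : 4 ≤ n) {c s t : ℝ} (hc : 0 < c) (hs : 0 < s) (ht : 0 < t)
    {x : m n} (h : metric c s t x x = 0) : x = 0 := by
  have hn' : (0 : ℝ) < n - 2 := by
    have : (4 : ℝ) ≤ n := by exact_mod_cast hn
    linarith
  rw [metric_eq hn] at h
  have hA : 0 ≤ ∑ i, coordA (x : so n) i * coordA (x : so n) i :=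
    Finset.sum_nonneg fun i _ => mul_self_nonneg _
  have hB' (j) : 0 ≤ ∑ i, coordB (x : so n) i j * coordB (x : so n) i j :=
    Finset.sum_nonneg fun i _ => mul_self_nonneg _
  have hB : 0 ≤ ∑ j, ∑ i, coordB (x : so n) i j * coordB (x : so n) i j :=
    Finset.sum_nonneg fun j _ => hB' j
  have hC : 0 ≤ ∑ j, coordC (x : so n) j * coordC (x : so n) j :=
    Finset.sum_nonneg fun i _ => mul_self_nonneg _
  have h' := (mul_eq_zero.1 h).resolve_left (by positivity)
  have hB1 := mul_nonneg hs.le hB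
  have hC1 := mul_nonneg ht.le hC
  have hA0 : ∑ i, coordA (x : so n) i * coordA (x : so n) i = 0 := by linarith
  have hB0 : ∑ j, ∑ i, coordB (x : so n) i j * coordB (x : so n) i j = 0 := by
    refine (mul_eq_zero.1 (?_ : s * _ = 0)).resolve_left hs.ne'
    linarith
  have hC0 : ∑ j, coordC (x : so n) j * coordC (x : so n) j = 0 := by
    refine (mul_eq_zero.1 (?_ : t * _ = 0)).resolve_left ht.ne'
    linarith
  rw [Finset.sum_eq_zero_iff_of_nonneg fun i _ => mul_self_nonneg _] at hA0 hC0
  rw [Finset.sum_eq_zero_iff_of_nonneg fun j _ => hB' j] at hB0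
  apply m_ext
  · ext i
    simpa using hA0 i (Finset.mem_univ i)
  · ext i j
    have := hB0 j (Finset.mem_univ j)
    rw [Finset.sum_eq_zero_iff_of_nonneg fun i _ => mul_self_nonneg _] at this
    simpa using this i (Finset.mem_univ i)
  · ext j
    simpa using hC0 j (Finset.mem_univ j)

theorem metric_sub_left (hn : 4 ≤ n) (c s t : ℝ) (x y z : m n) :
    metric c s t (x - y) z = metric c s t x z - metric c s t y z := by
  simp only [metric_eq hn, AddSubgroupClass.coe_sub, map_sub, Pi.sub_apply, sub_mul,
    Finset.sum_sub_distrib]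
  ring

theorem metric_symm (hn : 4 ≤ n) (c s t : ℝ) (x y : m n) :
    metric c s t x y = metric c s t y x := by
  simp only [metric_eq hn, mul_comm (coordA (x : so n) _), mul_comm (coordB (x : so n) _ _),
    mul_comm (coordC (x : so n) _)]

theorem metric_rot (hn : 4 ≤ n) (c s t α β : ℝ) (x y : m n) :
    metric c s t (rot α β x) y + metric c s t x (rot α β y) = 0 := by
  have h : (∑ j, ∑ i, coordB (rot α β x : so n) i j * coordB (y : so n) i j)
      + ∑ j, ∑ i, coordB (x : so n) i j * coordB (rot α β y : so n) i j = 0 := by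
    rw [← Finset.sum_add_distrib]
    refine Finset.sum_eq_zero fun j _ => ?_
    simp
    ring
  have h' : (∑ i, coordA (rot α β x : so n) i * coordA (y : so n) i)
      + ∑ i, coordA (x : so n) i * coordA (rot α β y : so n) i = 0 := by
    simp
    ring
  simp only [metric_eq hn, coordC_rot]
  simp only [Pi.zero_apply, zero_mul, mul_zero, Finset.sum_const_zero]
  linear_combination c * (2 * (n - 2)) * h' + c * (2 * (n - 2)) * s * h

/-! ### The difference between the Levi-Civita and the canonical connection -/

/-- The bilinear map `Λ : 𝔪 × 𝔪 → 𝔪` of the Levi-Civita connection of the metric with characteristic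
numbers `(s, t)`: `Λ(x, y) = ½ [x, y]_𝔪 + U(x, y)`, where
`2 ⟨U(x, y), z⟩ = ⟨x, [z, y]_𝔪⟩ + ⟨[z, x]_𝔪, y⟩`. -/
def lam (s t : ℝ) (x y : m n) : m n :=
  mkM
    (fun i => (1 + t - s) / 2 * ∑ j, coordB (x : so n) i j * coordC (y : so n) j
      + (t - s - 1) / 2 * ∑ j, coordB (y : so n) i j * coordC (x : so n) j)
    (fun i j => ((1 - t) / s - 1) / 2 * (coordA (x : so n) i * coordC (y : so n) j)
      + ((1 - t) / s + 1) / 2 * (coordA (y : so n) i * coordC (x : so n) j))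
    (fun j => ((s - 1) / t + 1) / 2 * ∑ i, coordA (x : so n) i * coordB (y : so n) i j
      + ((s - 1) / t - 1) / 2 * ∑ i, coordA (y : so n) i * coordB (x : so n) i j)

theorem coe_lie_apply (X Y : so n) (i j : Idx n) :
    ((⁅X, Y⁆ : so n) : Mat n) i j
      = ∑ k, (X : Mat n) i k * (Y : Mat n) k j - ∑ k, (Y : Mat n) i k * (X : Mat n) k j := rfl

section lie

variable (a a' : Fin 2 → ℝ) (b b' : Fin 2 → Fin (n - 3) → ℝ) (c c' : Fin (n - 3) → ℝ)

theorem coordA_lie_ofCoords (i) : coordA ⁅ofCoords a b c, ofCoords a' b' c'⁆ i =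
    ∑ j, b i j * c' j - ∑ j, b' i j * c j := by
  rw [coordA_apply, coe_lie_apply]
  simp [ofCoords, Fintype.sum_sum_type]
  simp only [mul_comm (c _), mul_comm (c' _)]
  ring

theorem coordB_lie_ofCoords (i j) : coordB ⁅ofCoords a b c, ofCoords a' b' c'⁆ i j =
    a' i * c j - a i * c' j := by
  rw [coordB_apply, coe_lie_apply]
  simp [ofCoords, Fintype.sum_sum_type]
  ring

theorem coordC_lie_ofCoords (j) : coordC ⁅ofCoords a b c, ofCoords a' b' c'⁆ j =
    ∑ i, a i * b' i j - ∑ i, a' i * b i j := by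
  rw [coordC_apply, coe_lie_apply]
  simp [ofCoords, Fintype.sum_sum_type]

end lie

/-- The symmetric part `U` of `Λ` cancels. -/
theorem lam_sub_lam_swap (s t : ℝ) (x y : m n) :
    lam s t x y - lam s t y x = projM ⁅(x : so n), (y : so n)⁆ := by
  have e : ⁅(x : so n), (y : so n)⁆
      = ⁅ofCoords (coordA (x : so n)) (coordB (x : so n)) (coordC (x : so n)),
        ofCoords (coordA (y : so n)) (coordB (y : so n)) (coordC (y : so n))⁆ := by
    rw [← eq_ofCoords_of_mem_m x.2, ← eq_ofCoords_of_mem_m y.2]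
  rw [e]
  apply m_ext
  · ext i
    simp only [lam, AddSubgroupClass.coe_sub, map_sub, Pi.sub_apply, coordA_mkM, coordA_projM,
      coordA_lie_ofCoords]
    ring
  · ext i j
    simp only [lam, AddSubgroupClass.coe_sub, map_sub, Pi.sub_apply, coordB_mkM, coordB_projM,
      coordB_lie_ofCoords]
    ring
  · ext j
    simp only [lam, AddSubgroupClass.coe_sub, map_sub, Pi.sub_apply, coordC_mkM, coordC_projM,
      coordC_lie_ofCoords]
    ring

/-- `Λ(x, ·)` is skew-symmetric for the metric. -/
theorem metric_lam (hn : 4 ≤ n) {s t : ℝ} (c : ℝ) (hs : s ≠ 0) (ht : t ≠ 0) (x y z : m n) :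
    metric c s t (lam s t x y) z + metric c s t y (lam s t x z) = 0 := by
  rw [metric_eq hn, metric_eq hn, ← mul_add]
  refine mul_eq_zero_of_right _ ?_
  simp only [lam, coordA_mkM, coordB_mkM, coordC_mkM, Fin.sum_univ_two]
  simp only [add_mul, mul_add, Finset.mul_sum, Finset.sum_mul, ← Finset.sum_add_distrib]
  refine Finset.sum_eq_zero fun j _ => ?_
  field_simp
  ring

/-! ### The algebraic conditions on `Λ` -/

/-- A test vector on which all components of `Λ(x, f x) - f Λ(x, x)` can be read off. -/
def testVec (j₀ : Fin (n - 3)) : m n := mkM ![1, 0] ![0, Pi.single j₀ 1] (Pi.single j₀ 1)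

theorem killing_condition (j₀ : Fin (n - 3)) {s t : ℝ} (hs : s ≠ 0) (ht : t ≠ 0) (α β : ℝ) :
    (∀ x : m n, lam s t x (rot α β x) = rot α β (lam s t x x)) ↔
      β * (t - s - 1) = 2 * α * (t - s) ∧ α * (s + 1 - t) = 2 * β * (1 - t) ∧
        (α + β) * t = (s - 1) * (α - β) := by
  constructor
  · intro h
    replace h := h (testVec j₀)
    have hA := congrFun (congrArg (fun x : m n => coordA (x : so n)) h) 0
    have hB := congrFun (congrFun (congrArg (fun x : m n => coordB (x : so n)) h) 1) j₀
    have hC := congrFun (congrArg (fun x : m n => coordC (x : so n)) h) j₀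
    simp [lam, testVec, Pi.single_apply] at hA hB hC
    field_simp at hB hC
    refine ⟨by linarith, by linarith, by linarith⟩
  · rintro ⟨h1, h2, h3⟩ x
    apply m_ext
    · ext i
      fin_cases i
      · simp [lam, mul_assoc, ← Finset.mul_sum]
        linear_combination (∑ j, coordB (x : so n) 1 j * coordC (x : so n) j) / 2 * h1
      · simp [lam, mul_assoc, ← Finset.mul_sum]
        linear_combination (∑ j, coordB (x : so n) 0 j * coordC (x : so n) j) / 2 * h1
    · ext i j
      fin_cases i
      · simp [lam]
        field_simp
        linear_combination (coordA (x : so n) 1 * coordC (x : so n) j) * h2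
      · simp [lam]
        field_simp
        linear_combination (coordA (x : so n) 0 * coordC (x : so n) j) * h2
    · ext j
      simp [lam]
      field_simp
      linear_combination (coordA (x : so n) 0 * coordB (x : so n) 1 j
        - coordA (x : so n) 1 * coordB (x : so n) 0 j) * h3

theorem nearlyKahler_condition (j₀ : Fin (n - 3)) {s t : ℝ} (ht : t ≠ 0) (α β : ℝ) :
    (∀ x : m n, lam s t (rot α β x) (rot α β (rot α β x))
        = rot α β (lam s t (rot α β x) (rot α β x))) ↔
      α * β * ((α + β) * t - (s - 1) * (α - β)) = 0 := by
  constructor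
  · intro h
    replace h := h (testVec j₀)
    have hC := congrFun (congrArg (fun x : m n => coordC (x : so n)) h) j₀
    simp [lam, testVec, Pi.single_apply] at hC
    field_simp at hC
    linarith
  · intro h x
    apply m_ext
    · ext i
      fin_cases i <;> simp [lam]
    · ext i j
      fin_cases i <;> simp [lam]
    · ext j
      simp [lam]
      field_simp
      linear_combination (coordA (x : so n) 0 * coordB (x : so n) 1 j
        - coordA (x : so n) 1 * coordB (x : so n) 0 j) * h

/-- `Λ` maps `(𝔪₁ ⊕ 𝔪₂) × (𝔪₁ ⊕ 𝔪₂)` into `𝔪₃`. -/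
theorem rot_lam_rot_rot (s t α β : ℝ) (x y : m n) :
    rot α β (lam s t (rot α β x) (rot α β y)) = 0 := by
  apply m_ext
  · ext i; fin_cases i <;> simp [lam]
  · ext i j; fin_cases i <;> simp [lam]
  · simp

/-- The hypotheses say that `α` and `β` are `0`, `1` or `-1`. -/
theorem rot_cube_add {α β : ℝ} (hα : α ^ 3 = α) (hβ : β ^ 3 = β) :
    (rot α β ^ 3 + rot α β : Module.End ℝ (m n)) = 0 := by
  ext1 x
  apply m_ext
  · ext i
    fin_cases i
    · simp [pow_succ]
      linear_combination (-coordA (x : so n) 1) * hα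
    · simp [pow_succ]
      linear_combination (coordA (x : so n) 0) * hα
  · ext i j
    fin_cases i
    · simp [pow_succ]
      linear_combination (-coordB (x : so n) 1 j) * hβ
    · simp [pow_succ]
      linear_combination (coordB (x : so n) 0 j) * hβ
  · simp [pow_succ]

/-! ### Derivatives along the curves `τ ↦ g exp(τ x)` -/

theorem coe_mul_expSO (g : SO n) (x : so n) (τ : ℝ) :
    ((g * expSO (τ • x) : SO n) : Mat n) = (g : Mat n) * NormedSpace.exp (τ • (x : Mat n)) := rfl

theorem mul_expSO_zero (g : SO n) (x : so n) : g * expSO ((0 : ℝ) • x) = g := by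
  apply Subtype.ext
  rw [coe_mul_expSO]
  simp

/-- The norm on matrices in force is the underlying norm of a normed algebra, for which the product
rule is available. -/
theorem hasDerivAt_mat_mul {γ δ : ℝ → Mat n} {γ' δ' : Mat n} {τ : ℝ} (hγ : HasDerivAt γ γ' τ)
    (hδ : HasDerivAt δ δ' τ) :
    HasDerivAt (fun σ => γ σ * δ σ) (γ' * δ τ + γ τ * δ') τ := by
  let _ : NormedRing (Mat n) := Matrix.linftyOpNormedRing
  let _ : NormedAlgebra ℝ (Mat n) := Matrix.linftyOpNormedAlgebra
  exact HasDerivAt.fun_mul hγ hδ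

theorem contDiff_mat_mul {F G : Mat n → Mat n} (hF : ContDiff ℝ ∞ F) (hG : ContDiff ℝ ∞ G) :
    ContDiff ℝ ∞ fun A => F A * G A := by
  let _ : NormedRing (Mat n) := Matrix.linftyOpNormedRing
  let _ : NormedAlgebra ℝ (Mat n) := Matrix.linftyOpNormedAlgebra
  exact ContDiff.mul hF hG

theorem hasDerivAt_mat_linear {E : Type*} [NormedAddCommGroup E] [NormedSpace ℝ E]
    (L : Mat n →ₗ[ℝ] E) {γ : ℝ → Mat n} {γ' : Mat n} {τ : ℝ} (hγ : HasDerivAt γ γ' τ) :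
    HasDerivAt (fun σ => L (γ σ)) (L γ') τ :=
  (LinearMap.toContinuousLinearMap L).hasFDerivAt.comp_hasDerivAt τ hγ

theorem contDiff_mat_linear {E : Type*} [NormedAddCommGroup E] [NormedSpace ℝ E]
    (L : Mat n →ₗ[ℝ] E) : ContDiff ℝ ∞ L :=
  (LinearMap.toContinuousLinearMap L).contDiff

theorem hasDerivAt_mul_expSO (g : SO n) (x : so n) :
    HasDerivAt (fun τ : ℝ => ((g * expSO (τ • x) : SO n) : Mat n)) ((g : Mat n) * (x : Mat n)) 0 := by
  have h : HasDerivAt (fun τ : ℝ => NormedSpace.exp (τ • (x : Mat n))) (x : Mat n) 0 := by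
    let _ : NormedRing (Mat n) := Matrix.linftyOpNormedRing
    let _ : NormedAlgebra ℝ (Mat n) := Matrix.linftyOpNormedAlgebra
    have := hasDerivAt_exp_smul_const (𝕂 := ℝ) (x : Mat n) 0
    rwa [zero_smul, NormedSpace.exp_zero, one_mul] at this
  have h' := hasDerivAt_mat_mul (hasDerivAt_const (0 : ℝ) (g : Mat n)) h
  rw [zero_mul, zero_add] at h'
  exact h'

/-- The inclusion of `𝔪` into the space of matrices. -/
def incl : m n →ₗ[ℝ] Mat n := (so n).toSubmodule.subtype ∘ₗ (m n).subtype

/-- A linear retraction of the space of matrices to `𝔪`. -/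
def retr : Mat n →ₗ[ℝ] m n := projM ∘ₗ skewPart

theorem retr_incl (x : m n) : retr (incl x) = x := by
  change projM (skewPart ((x : so n) : Mat n)) = x
  rw [skewPart_coe, projM_coe]

/-- `v` is the derivative of the `𝔪`-valued function `Y` along the curve `τ ↦ g exp(τ x)`. -/
def HasDerivAlong (g : SO n) (x : so n) (Y : SO n → m n) (v : m n) : Prop :=
  HasDerivAt (fun τ : ℝ => incl (Y (g * expSO (τ • x)))) (incl v) 0

theorem HasDerivAlong.functional {g : SO n} {x : so n} {Y : SO n → m n} {v : m n}
    (h : HasDerivAlong g x Y v) (ℓ : m n →ₗ[ℝ] ℝ) :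
    HasDerivAt (fun τ : ℝ => ℓ (Y (g * expSO (τ • x)))) (ℓ v) 0 := by
  simpa [retr_incl] using hasDerivAt_mat_linear (ℓ ∘ₗ retr) h

theorem HasDerivAlong.map {g : SO n} {x : so n} {Y : SO n → m n} {v : m n}
    (h : HasDerivAlong g x Y v) (f : Module.End ℝ (m n)) :
    HasDerivAlong g x (fun a => f (Y a)) (f v) := by
  have h' := hasDerivAt_mat_linear (incl ∘ₗ f ∘ₗ retr) h
  simp only [LinearMap.comp_apply, retr_incl] at h'
  exact h'

theorem HasDerivAlong.unique {g : SO n} {x : so n} {Y : SO n → m n} {v w : m n}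
    (h : HasDerivAlong g x Y v) (h' : HasDerivAlong g x Y w) : v = w := by
  rw [← retr_incl v, ← retr_incl w, HasDerivAt.unique h h']

/-- The derivative of a smooth extension of `Y` to matrices need not lie in `𝔪`; its retraction to
`𝔪` is the derivative of `Y`. -/
theorem exists_hasDerivAlong (Y : VectorField n) (g : SO n) (x : so n) :
    ∃ v, HasDerivAlong g x Y.1 v := by
  obtain ⟨Y, ⟨F, hF, hY⟩, -⟩ := Y
  have h1 : HasDerivAt (fun τ : ℝ => F ((g * expSO (τ • x) : SO n) : Mat n))
      (fderiv ℝ F (g : Mat n) ((g : Mat n) * (x : Mat n))) 0 := by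
    have hF' : HasFDerivAt F (fderiv ℝ F (g : Mat n))
        ((g * expSO ((0 : ℝ) • x) : SO n) : Mat n) := by
      rw [mul_expSO_zero]
      exact (hF.differentiable (by simp) _).hasFDerivAt
    exact hF'.comp_hasDerivAt (0 : ℝ) (hasDerivAt_mul_expSO g x)
  refine ⟨retr (fderiv ℝ F (g : Mat n) ((g : Mat n) * (x : Mat n))), ?_⟩
  have h2 := hasDerivAt_mat_linear (incl ∘ₗ retr) h1
  refine h2.congr_of_eventuallyEq (Filter.Eventually.of_forall fun τ => ?_)
  have : F ((g * expSO (τ • x) : SO n) : Mat n) = incl (Y (g * expSO (τ • x))) := (hY _).symm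
  change incl (Y (g * expSO (τ • x))) = incl (retr (F ((g * expSO (τ • x) : SO n) : Mat n)))
  rw [this, retr_incl]

/-- The canonical connection: the derivative of the vector field `Y`, viewed as an `𝔪`-valued
function on `SO(n)`, along the vector field `X`. -/
def canon (X Y : VectorField n) (g : SO n) : m n :=
  (exists_hasDerivAlong Y g (X.1 g : so n)).choose

theorem hasDerivAlong_canon (X Y : VectorField n) (g : SO n) :
    HasDerivAlong g (X.1 g : so n) Y.1 (canon X Y g) :=
  (exists_hasDerivAlong Y g (X.1 g : so n)).choose_spec

/-- Invariant affinor structures are parallel for the canonical connection. -/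
theorem canon_appF (f : Affinor n) (X Y : VectorField n) (g : SO n) :
    canon X (appF f Y) g = (f : Module.End ℝ (m n)) (canon X Y g) :=
  (hasDerivAlong_canon X (appF f Y) g).unique
    ((hasDerivAlong_canon X Y g).map (f : Module.End ℝ (m n)))

theorem lieD_metric (hn : 4 ≤ n) (c s t : ℝ) (X Y Z : VectorField n) (g : SO n) :
    lieD X (fun a => metric c s t (Y.1 a) (Z.1 a)) g =
      metric c s t (canon X Y g) (Z.1 g) + metric c s t (Y.1 g) (canon X Z g) := by
  have hY := hasDerivAlong_canon X Y g
  have hZ := hasDerivAlong_canon X Z g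
  have key (ℓ : m n →ₗ[ℝ] ℝ) := (hY.functional ℓ).fun_mul (hZ.functional ℓ)
  simp only [mul_expSO_zero] at key
  have hA := HasDerivAt.fun_sum (u := Finset.univ) fun i _ =>
    key (LinearMap.proj i ∘ₗ coordA ∘ₗ (m n).subtype)
  have hB := HasDerivAt.fun_sum (u := Finset.univ) fun j _ =>
    HasDerivAt.fun_sum (u := Finset.univ) fun i _ =>
      key (LinearMap.proj j ∘ₗ LinearMap.proj i ∘ₗ coordB ∘ₗ (m n).subtype)
  have hC := HasDerivAt.fun_sum (u := Finset.univ) fun j _ =>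
    key (LinearMap.proj j ∘ₗ coordC ∘ₗ (m n).subtype)
  have h := ((hA.fun_add (hB.const_mul s)).fun_add (hC.const_mul t)).const_mul (c * (2 * (n - 2)))
  have e : (fun a => metric c s t (Y.1 a) (Z.1 a)) = _ :=
    funext fun a : SO n => metric_eq hn c s t (Y.1 a) (Z.1 a)
  rw [e]
  refine h.deriv.trans ?_
  simp only [metric_eq hn, Finset.sum_add_distrib]
  simp only [LinearMap.comp_apply, LinearMap.proj_apply, Submodule.subtype_apply]
  ring

/-! ### Smooth functions that separate tangent vectors -/

/-- The diagonal matrix `diag(0, 1, 1, 2, …, 2)`, which commutes with `H`. -/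
def blkMat (n : ℕ) : Mat n := Matrix.diagonal fun i => ((blk i : ℕ) : ℝ)

theorem blkMat_conj (h : H n) :
    ((h : SO n) : Mat n) * blkMat n * ((h : SO n) : Mat n)ᵀ = blkMat n := by
  obtain ⟨P, hP, Q, hQ, hh⟩ := h.2
  have hP' := (Matrix.mem_orthogonalGroup_iff _ _).1 (Matrix.mem_specialOrthogonalGroup_iff.1 hP).1
  have hQ' := (Matrix.mem_orthogonalGroup_iff _ _).1 (Matrix.mem_specialOrthogonalGroup_iff.1 hQ).1
  have e : blkMat n = Matrix.fromBlocks 0 0 0 (Matrix.fromBlocks 1 0 0 ((2 : ℝ) • 1)) := by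
    ext (i | i | i) (j | j | j) <;>
      simp [blkMat, blk, Matrix.diagonal_apply, Matrix.one_apply]
  rw [hh, e, blockDiag]
  simp [Matrix.fromBlocks_multiply, Matrix.fromBlocks_transpose, hP', hQ']

theorem contDiff_conj (K : Mat n) : ContDiff ℝ ∞ fun A : Mat n => A * K * Aᵀ :=
  contDiff_mat_mul (contDiff_mat_mul contDiff_id contDiff_const)
    (contDiff_mat_linear (Matrix.transposeLinearEquiv (Idx n) (Idx n) ℝ ℝ).toLinearMap)

/-- The entries of `g K gᵀ`, for `K = blkMat n`, as smooth functions on `SO(n)/H`. -/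
def conjFun (i j : Idx n) : Smooth n :=
  ⟨fun p => Quotient.liftOn' p (fun g : SO n => ((g : Mat n) * blkMat n * (g : Mat n)ᵀ) i j) (by
    intro a b hab
    rw [QuotientGroup.leftRel_apply] at hab
    have hb : b = a * (⟨a⁻¹ * b, hab⟩ : H n) := by simp
    have := blkMat_conj (⟨a⁻¹ * b, hab⟩ : H n)
    rw [hb, Submonoid.coe_mul, Matrix.transpose_mul]
    generalize (((⟨a⁻¹ * b, hab⟩ : H n) : SO n) : Mat n) = k at this
    have e : (a : Mat n) * blkMat n * (a : Mat n)ᵀ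
        = (a : Mat n) * k * blkMat n * (kᵀ * (a : Mat n)ᵀ) := by
      conv_lhs => rw [← this]
      simp only [Matrix.mul_assoc]
    exact congrFun (congrFun e i) j),
   fun A => (A * blkMat n * Aᵀ) i j,
   (contDiff_mat_linear (Matrix.entryLinearMap ℝ ℝ i j)).comp (contDiff_conj (blkMat n)),
   fun _ => rfl⟩

theorem pull_conjFun (i j : Idx n) :
    pull (conjFun i j) = fun g : SO n => ((g : Mat n) * blkMat n * (g : Mat n)ᵀ) i j := rfl

theorem lieD_conj (X : VectorField n) (g : SO n) (K : SO n → Mat n) (K' : Mat n)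
    (hK : HasDerivAt (fun τ : ℝ => K (g * expSO (τ • (X.1 g : so n)))) K' 0) (i j : Idx n) :
    lieD X (fun a => ((a : Mat n) * K a * (a : Mat n)ᵀ) i j) g =
      ((g : Mat n) * (incl (X.1 g) * K g - K g * incl (X.1 g) + K') * (g : Mat n)ᵀ) i j := by
  have h1 := hasDerivAt_mul_expSO g (X.1 g : so n)
  have h2 := hasDerivAt_mat_linear
    (Matrix.transposeLinearEquiv (Idx n) (Idx n) ℝ ℝ).toLinearMap h1
  have h3 := hasDerivAt_mat_linear (Matrix.entryLinearMap ℝ ℝ i j)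
    (hasDerivAt_mat_mul (hasDerivAt_mat_mul h1 hK) h2)
  refine h3.deriv.trans ?_
  have hX : (incl (X.1 g))ᵀ = -incl (X.1 g) :=
    (LieAlgebra.Orthogonal.mem_so (Idx n) ℝ _).1 (X.1 g : so n).2
  change (((g : Mat n) * incl (X.1 g) * K (g * expSO ((0 : ℝ) • (X.1 g : so n)))
    + ((g * expSO ((0 : ℝ) • (X.1 g : so n)) : SO n) : Mat n) * K')
      * ((g * expSO ((0 : ℝ) • (X.1 g : so n)) : SO n) : Mat n)ᵀ
    + ((g * expSO ((0 : ℝ) • (X.1 g : so n)) : SO n) : Mat n)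
      * K (g * expSO ((0 : ℝ) • (X.1 g : so n))) * ((g : Mat n) * incl (X.1 g))ᵀ) i j = _
  rw [mul_expSO_zero, Matrix.transpose_mul, hX]
  refine congrFun (congrFun ?_ i) j
  noncomm_ring

theorem transpose_mul_self_SO (g : SO n) : (g : Mat n)ᵀ * (g : Mat n) = 1 := by
  rw [← coe_inv, ← Submonoid.coe_mul, inv_mul_cancel]
  rfl

theorem conj_SO_injective (g : SO n) {K L : Mat n}
    (h : (g : Mat n) * K * (g : Mat n)ᵀ = (g : Mat n) * L * (g : Mat n)ᵀ) : K = L := by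
  have e (K : Mat n) : (g : Mat n)ᵀ * ((g : Mat n) * K * (g : Mat n)ᵀ) * (g : Mat n) = K := by
    calc _ = ((g : Mat n)ᵀ * (g : Mat n)) * K * ((g : Mat n)ᵀ * (g : Mat n)) := by
          simp only [Matrix.mul_assoc]
      _ = K := by rw [transpose_mul_self_SO, one_mul, mul_one]
  rw [← e K, h, e]

/-- The entries of `[X, blkMat n]` outside of the diagonal blocks are non-zero multiples of those of
`X`. -/
theorem projM_eq_of_commutator_blkMat {X Y : so n}
    (h : (X : Mat n) * blkMat n - blkMat n * (X : Mat n)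
      = (Y : Mat n) * blkMat n - blkMat n * (Y : Mat n)) : projM X = projM Y := by
  have e (i j : Idx n) := congrFun (congrFun h i) j
  simp only [blkMat, Matrix.sub_apply, Matrix.mul_diagonal, Matrix.diagonal_mul] at e
  apply m_ext
  · ext i
    have := e (.inl 0) (.inr (.inl i))
    rw [coordA_projM, coordA_projM]
    simpa [blk, coordA_apply] using this
  · ext i j
    have := e (.inr (.inl i)) (.inr (.inr j))
    simp [blk] at this
    rw [coordB_projM, coordB_projM, coordB_apply, coordB_apply]
    linarith
  · ext j
    have := e (.inl 0) (.inr (.inr j))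
    rw [coordC_projM, coordC_projM]
    simpa [blk, coordC_apply] using this

/-! ### Vector fields with prescribed values -/

theorem Ad_mul (a b : SO n) (X : so n) : Ad (a * b) X = Ad a (Ad b X) := by
  apply Subtype.ext
  simp [Ad, coe_inv, Matrix.mul_assoc]

/-- The vector field on `SO(n)/H` generated by `N` through the action of `SO(n)`: its value at `g` is
the projection of `Ad(g⁻¹) N` to `𝔪`. -/
def fundField (N : so n) : VectorField n :=
  ⟨fun g => projM (Ad g⁻¹ N), by
    refine ⟨⟨fun A => incl (retr (Aᵀ * (N : Mat n) * A)), ?_, fun g => ?_⟩, fun g h => ?_⟩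
    · exact (contDiff_mat_linear (incl ∘ₗ retr)).comp (contDiff_mat_mul (contDiff_mat_mul
        (contDiff_mat_linear (Matrix.transposeLinearEquiv (Idx n) (Idx n) ℝ ℝ).toLinearMap)
        contDiff_const) contDiff_id)
    · have : (g : Mat n)ᵀ * (N : Mat n) * (g : Mat n) = (Ad g⁻¹ N : so n) := by
        simp [Ad, coe_inv]
      dsimp only
      rw [this, retr, LinearMap.comp_apply, skewPart_coe]
      rfl
    · dsimp only
      rw [mul_inv_rev, Ad_mul, ← Subgroup.coe_inv, projM_Ad]⟩

/-- The vector field generated by `Ad(g) v` has the value `v` at `g`. -/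
theorem exists_vectorField (g : SO n) (v : m n) : ∃ X : VectorField n, X.1 g = v := by
  refine ⟨fundField (Ad g (v : so n)), ?_⟩
  change projM (Ad g⁻¹ (Ad g (v : so n))) = v
  rw [← Ad_mul, inv_mul_cancel]
  have : Ad (1 : SO n) (v : so n) = v := Subtype.ext (by simp [Ad])
  rw [this, projM_coe]

/-! ### The Levi-Civita connection -/

/-- The map `K ↦ [K, blkMat n]`. -/
def adBlk (n : ℕ) : Mat n →ₗ[ℝ] Mat n :=
  LinearMap.mulRight ℝ (blkMat n) - LinearMap.mulLeft ℝ (blkMat n)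

theorem adBlk_apply (K : Mat n) : adBlk n K = K * blkMat n - blkMat n * K := rfl

theorem lieD_pull_conjFun (X : VectorField n) (i j : Idx n) :
    lieD X (pull (conjFun i j)) =
      fun a : SO n => ((a : Mat n) * adBlk n (incl (X.1 a)) * (a : Mat n)ᵀ) i j := by
  funext a
  rw [pull_conjFun, lieD_conj X a (fun _ => blkMat n) 0 (hasDerivAt_const _ _), add_zero,
    adBlk_apply]

theorem lieD_lieD_pull_conjFun (X Y : VectorField n) (g : SO n) (i j : Idx n) :
    lieD X (lieD Y (pull (conjFun i j))) g =
      ((g : Mat n) * (incl (X.1 g) * adBlk n (incl (Y.1 g)) - adBlk n (incl (Y.1 g)) * incl (X.1 g)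
        + adBlk n (incl (canon X Y g))) * (g : Mat n)ᵀ) i j := by
  rw [lieD_pull_conjFun]
  exact lieD_conj X g (fun a => adBlk n (incl (Y.1 a))) _
    (hasDerivAt_mat_linear (adBlk n) (hasDerivAlong_canon X Y g)) i j

variable {c s t : ℝ} {nab : VectorField n → VectorField n → VectorField n}

theorem sub_sub_sub_eq_of_projM_eq {u v x y : m n} {L : so n}
    (h : projM ((u - v : m n) : so n) = projM (L + (x : so n) - (y : so n))) :
    (u - x) - (v - y) = projM L := by
  rw [map_sub, map_add, projM_coe, projM_coe x, projM_coe y] at h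
  rw [sub_sub_sub_comm, h]
  abel

/-- Freeness of torsion, expressed by means of the canonical connection, whose torsion is
`-[X, Y]_𝔪`. -/
theorem nab_sub_nab_swap (hnab : IsLeviCivita c s t nab) (X Y : VectorField n) (g : SO n) :
    ((nab X Y).1 g - canon X Y g) - ((nab Y X).1 g - canon Y X g)
      = projM ⁅(X.1 g : so n), (Y.1 g : so n)⁆ := by
  have h : adBlk n (incl ((nab X Y - nab Y X).1 g))
      = (incl (X.1 g) * adBlk n (incl (Y.1 g)) - adBlk n (incl (Y.1 g)) * incl (X.1 g)
        + adBlk n (incl (canon X Y g)))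
        - (incl (Y.1 g) * adBlk n (incl (X.1 g)) - adBlk n (incl (X.1 g)) * incl (Y.1 g)
        + adBlk n (incl (canon Y X g))) := by
    apply conj_SO_injective g
    ext i j
    have := hnab.torsion_free X Y (conjFun i j) g
    rw [lieD_pull_conjFun, lieD_lieD_pull_conjFun, lieD_lieD_pull_conjFun] at this
    rw [mul_sub, sub_mul]
    exact this
  have h' : projM ((nab X Y - nab Y X).1 g : so n)
      = projM (⁅(X.1 g : so n), (Y.1 g : so n)⁆ + (canon X Y g : so n) - (canon Y X g : so n)) := by
    apply projM_eq_of_commutator_blkMat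
    change adBlk n (incl ((nab X Y - nab Y X).1 g))
      = adBlk n (incl (X.1 g) * incl (Y.1 g) - incl (Y.1 g) * incl (X.1 g)
        + incl (canon X Y g) - incl (canon Y X g))
    rw [h]
    simp only [adBlk_apply]
    noncomm_ring
  exact sub_sub_sub_eq_of_projM_eq h'

/-- The Levi-Civita connection differs from the canonical connection by `Λ`. -/
theorem nab_eq (hn : 4 ≤ n) (hc : 0 < c) (hs : 0 < s) (ht : 0 < t)
    (hnab : IsLeviCivita c s t nab) (X Y : VectorField n) (g : SO n) :
    (nab X Y).1 g = canon X Y g + lam s t (X.1 g) (Y.1 g) := by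
  let E (X Y : VectorField n) : m n := (nab X Y).1 g - canon X Y g - lam s t (X.1 g) (Y.1 g)
  have hsymm (X Y : VectorField n) : E X Y = E Y X := by
    have h := nab_sub_nab_swap hnab X Y g
    rw [← lam_sub_lam_swap s t] at h
    rw [← sub_eq_zero] at h ⊢
    rw [← h]
    simp only [E]
    abel
  have hskew (X Y Z : VectorField n) :
      metric c s t (E X Y) (Z.1 g) = -metric c s t (Y.1 g) (E X Z) := by
    have h := hnab.metric_compat X Y Z g
    rw [lieD_metric hn] at h
    have h' := metric_lam hn c hs.ne' ht.ne' (X.1 g) (Y.1 g) (Z.1 g)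
    rw [metric_symm hn _ _ _ (Y.1 g), metric_symm hn _ _ _ (Y.1 g)] at h
    rw [metric_symm hn _ _ _ (Y.1 g)] at h' ⊢
    simp only [E, metric_sub_left hn]
    linarith
  -- As in the Koszul formula: `⟨E(X, Y), Z⟩` is symmetric in `X, Y` and skew in `Y, Z`, hence zero.
  have hzero (Z : VectorField n) : metric c s t (E X Y) (Z.1 g) = 0 := by
    have h1 := hskew X Y Z
    have h2 := hskew Z X Y
    have h3 := hskew Y Z X
    rw [hsymm X Z, metric_symm hn _ _ _ (Y.1 g)] at h1
    rw [hsymm Z Y, metric_symm hn _ _ _ (X.1 g)] at h2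
    rw [hsymm Y X, metric_symm hn _ _ _ (Z.1 g)] at h3
    linarith
  obtain ⟨Z, hZ⟩ := exists_vectorField g (E X Y)
  have h := hzero Z
  rw [hZ] at h
  have := eq_zero_of_metric_self hn hc hs ht h
  rw [← sub_eq_zero, ← sub_sub]
  exact this

/-- The covariant derivative of an invariant affinor structure is given by `Λ` alone, as the
structure is parallel for the canonical connection. -/
theorem covD_apply (hn : 4 ≤ n) (hc : 0 < c) (hs : 0 < s) (ht : 0 < t)
    (hnab : IsLeviCivita c s t nab) (f : Affinor n) (X Y : VectorField n) (g : SO n) :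
    (covD nab f X Y).1 g = lam s t (X.1 g) ((f : Module.End ℝ (m n)) (Y.1 g))
      - (f : Module.End ℝ (m n)) (lam s t (X.1 g) (Y.1 g)) := by
  change (nab X (appF f Y)).1 g - (f : Module.End ℝ (m n)) ((nab X Y).1 g) = _
  rw [nab_eq hn hc hs ht hnab, nab_eq hn hc hs ht hnab, canon_appF, map_add]
  change _ + lam s t (X.1 g) ((f : Module.End ℝ (m n)) (Y.1 g)) - _ = _
  abel

/-! ### The classes of invariant `f`-structures -/

theorem isMetricF_of_rot (hn : 4 ≤ n) {f : Affinor n} {α β : ℝ}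
    (hf : (f : Module.End ℝ (m n)) = rot α β) (hα : α ^ 3 = α) (hβ : β ^ 3 = β) :
    IsMetricF c s t f := by
  refine ⟨Subtype.ext ?_, fun X Y g => ?_⟩
  · change (f : Module.End ℝ (m n)) ^ 3 + (f : Module.End ℝ (m n)) = 0
    rw [hf, rot_cube_add hα hβ]
  · change metric c s t ((f : Module.End ℝ (m n)) (X.1 g)) (Y.1 g)
      + metric c s t (X.1 g) ((f : Module.End ℝ (m n)) (Y.1 g)) = 0
    rw [hf, metric_rot hn]

theorem isKilling_iff_of_rot (hn : 4 ≤ n) (hc : 0 < c) (hs : 0 < s) (ht : 0 < t)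
    (hnab : IsLeviCivita c s t nab) {f : Affinor n} {α β : ℝ}
    (hf : (f : Module.End ℝ (m n)) = rot α β) (hα : α ^ 3 = α) (hβ : β ^ 3 = β) :
    IsKilling c s t nab f ↔ β * (t - s - 1) = 2 * α * (t - s) ∧
      α * (s + 1 - t) = 2 * β * (1 - t) ∧ (α + β) * t = (s - 1) * (α - β) := by
  rw [IsKilling, and_iff_right (isMetricF_of_rot hn hf hα hβ),
    ← killing_condition (⟨0, by omega⟩ : Fin (n - 3)) hs.ne' ht.ne']
  constructor
  · intro h x
    obtain ⟨X, rfl⟩ := exists_vectorField 1 x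
    have h1 := covD_apply hn hc hs ht hnab f X X 1
    rw [h X, hf] at h1
    exact sub_eq_zero.1 h1.symm
  · intro h X
    refine Subtype.ext (funext fun g => ?_)
    rw [covD_apply hn hc hs ht hnab, hf, h, sub_self]
    rfl

theorem isNKf_iff_of_rot (hn : 4 ≤ n) (hc : 0 < c) (hs : 0 < s) (ht : 0 < t)
    (hnab : IsLeviCivita c s t nab) {f : Affinor n} {α β : ℝ}
    (hf : (f : Module.End ℝ (m n)) = rot α β) (hα : α ^ 3 = α) (hβ : β ^ 3 = β) :
    IsNKf c s t nab f ↔ α * β * ((α + β) * t - (s - 1) * (α - β)) = 0 := by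
  have hfX (X : VectorField n) (g : SO n) : (appF f X).1 g = rot α β (X.1 g) := by
    rw [← hf]
    rfl
  rw [IsNKf, and_iff_right (isMetricF_of_rot hn hf hα hβ),
    ← nearlyKahler_condition (⟨0, by omega⟩ : Fin (n - 3)) ht.ne']
  constructor
  · intro h x
    obtain ⟨X, rfl⟩ := exists_vectorField 1 x
    have h1 := covD_apply hn hc hs ht hnab f (appF f X) (appF f X) 1
    rw [h X, hf, hfX] at h1
    exact sub_eq_zero.1 h1.symm
  · intro h X
    refine Subtype.ext (funext fun g => ?_)
    rw [covD_apply hn hc hs ht hnab, hf, hfX, h, sub_self]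
    rfl

theorem isG1f_of_rot (hn : 4 ≤ n) (hc : 0 < c) (hs : 0 < s) (ht : 0 < t)
    (hnab : IsLeviCivita c s t nab) {f : Affinor n} {α β : ℝ}
    (hf : (f : Module.End ℝ (m n)) = rot α β) (hα : α ^ 3 = α) (hβ : β ^ 3 = β) :
    IsG1f c s t nab f := by
  have hfX (X : VectorField n) (g : SO n) : (appF f X).1 g = rot α β (X.1 g) := by
    rw [← hf]
    rfl
  have hD (X Y : VectorField n) (g : SO n) :
      rot α β ((covD nab f (appF f X) (appF f Y)).1 g) = 0 := by
    rw [covD_apply hn hc hs ht hnab, hf, hfX, hfX, map_sub, rot_lam_rot_rot, rot_lam_rot_rot,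
      map_zero, sub_zero]
  refine ⟨isMetricF_of_rot hn hf hα hβ, fun X => Subtype.ext (funext fun g => ?_)⟩
  change (1 / 4 : ℝ) • (appF f (covD nab f (appF f X) (appF f X)
    - covD nab f (appF f (appF f X)) (appF f (appF f X)))).1 g = 0
  rw [hfX]
  change (1 / 4 : ℝ) • rot α β ((covD nab f (appF f X) (appF f X)).1 g
    - (covD nab f (appF f (appF f X)) (appF f (appF f X))).1 g) = 0
  rw [map_sub, hD, hD, sub_zero, smul_zero]

end

end FlagSO

theorem theorem3 (n : ℕ) (hn : 4 ≤ n) (c s t : ℝ) (hc : 0 < c) (hs : 0 < s) (ht : 0 < t)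
    (nab : VectorField n → VectorField n → VectorField n) (hnab : IsLeviCivita c s t nab) :
    ((IsKilling c s t nab (f₁ n) ↔ s = 1 ∧ t = 4 / 3) ∧
      ¬ IsKilling c s t nab (f₂ n) ∧
      ¬ IsKilling c s t nab (f₃ n) ∧
      ¬ IsKilling c s t nab (f₄ n)) ∧
    ((IsNKf c s t nab (f₁ n) ↔ s = 1) ∧
      IsNKf c s t nab (f₂ n) ∧
      IsNKf c s t nab (f₃ n) ∧
      ¬ IsNKf c s t nab (f₄ n)) ∧
    (IsG1f c s t nab (f₁ n) ∧
      IsG1f c s t nab (f₂ n) ∧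
      IsG1f c s t nab (f₃ n) ∧
      IsG1f c s t nab (f₄ n)) := by
  have h11 : (1 : ℝ) ^ 3 = 1 := by norm_num
  have h00 : (0 : ℝ) ^ 3 = 0 := by norm_num
  have hmm : (-1 : ℝ) ^ 3 = -1 := by norm_num
  refine ⟨⟨?_, ?_, ?_, ?_⟩, ⟨?_, ?_, ?_, ?_⟩, ?_, ?_, ?_, ?_⟩
  · rw [isKilling_iff_of_rot hn hc hs ht hnab coe_f₁ h11 hmm]
    constructor
    · rintro ⟨h1, -, h3⟩
      constructor <;> linarith
    · rintro ⟨rfl, rfl⟩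
      norm_num
  · rw [isKilling_iff_of_rot hn hc hs ht hnab coe_f₂ h00 hmm]
    rintro ⟨-, h2, h3⟩
    linarith
  · rw [isKilling_iff_of_rot hn hc hs ht hnab coe_f₃ h11 h00]
    rintro ⟨h1, -, h3⟩
    linarith
  · rw [isKilling_iff_of_rot hn hc hs ht hnab coe_f₄ h11 h11]
    rintro ⟨-, -, h3⟩
    linarith
  · rw [isNKf_iff_of_rot hn hc hs ht hnab coe_f₁ h11 hmm]
    constructor
    · intro h
      linarith
    · rintro rfl
      norm_num
  · rw [isNKf_iff_of_rot hn hc hs ht hnab coe_f₂ h00 hmm]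
    norm_num
  · rw [isNKf_iff_of_rot hn hc hs ht hnab coe_f₃ h11 h00]
    norm_num
  · rw [isNKf_iff_of_rot hn hc hs ht hnab coe_f₄ h11 h11]
    intro h
    linarith
  · exact isG1f_of_rot hn hc hs ht hnab coe_f₁ h11 hmm
  · exact isG1f_of_rot hn hc hs ht hnab coe_f₂ h00 hmm
  · exact isG1f_of_rot hn hc hs ht hnab coe_f₃ h11 h00
  · exact isG1f_of_rot hn hc hs ht hnab coe_f₄ h11 h11
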